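/- \textbf{Setting.} In coordinates $(u,r,x,y)$ on an open set $\Omega\subseteq\{r>0\}\subset\mathbb R^4$ consider the metric $$ds^2=-(2H+Q)\,du^2-2\,du\,dr+\frac{r^2}{P^2}(dx^2+dy^2),\qquad 2H=K-2r(\ln P)_{,u}-\frac{2m}{r}-\frac{\Lambda}{3}r^2,$$ where $P=P(u,x,y)>0$, $m=m(u)$, $Q=Q(u,r)$ are smooth, $\Lambda$ is a constant and $K=P^2(\partial_x^2+\partial_y^2)\ln P$, together with the electromagnetic field $F_{ur}=-F_{ru}=E(u,r)$, $E$ smooth, all other components being zero. They form a \emph{solution} for a Lagrangian $\mathcal L(F)$, smooth at the values of $F=F_{\mu\nu}F^{\mu\nu}$ that occur, if on $\Omega$ $$G^\mu{}_\nu=T^\mu{}_\nu-\Lambda\delta^\mu_\nu,\quad T^\mu{}_\nu=\tfrac12\{\delta^\mu_\nu\mathcal L-4F_{\nu\lambda}F^{\mu\lambda}\mathcal L_F\},\quad \partial_\mu(\sqrt{-g}\,\mathcal L_FF^{\mu\nu})=0,$$ and $E$ and $\mathcal L_F$ vanish nowhere. A \emph{charge function} of the solution is a smooth $q(u)$ with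 $|\mathcal L_FF_{ur}|=q^2/r^2$ on $\Omega$. Weyl scalars refer to $$\mathbf k=\partial_r,\quad \mathbf l=\partial_u-(H+Q/2)\partial_r,\quad \mathbf m=\frac{P}{\sqrt2\,r}(\partial_x+i\partial_y)$$ (signature $(-,+,+,+)$), with $\Psi_0=C(\mathbf k,\mathbf m,\mathbf k,\mathbf m)$, $\Psi_1=C(\mathbf k,\mathbf l,\mathbf k,\mathbf m)$, $\Psi_2=C(\mathbf k,\mathbf m,\bar{\mathbf m},\mathbf l)$, $\Psi_3=C(\mathbf l,\mathbf k,\mathbf l,\bar{\mathbf m})$, $\Psi_4=C(\mathbf l,\bar{\mathbf m},\mathbf l,\bar{\mathbf m})$, where $C$ is the Weyl tensor. Put $I=\Psi_0\Psi_4-4\Psi_1\Psi_3+3\Psi_2^2$, $$J=\det\begin{pmatrix}\Psi_4&\Psi_3&\Psi_2\\ \Psi_3&\Psi_2&\Psi_1\\ \Psi_2&\Psi_1&\Psi_0\end{pmatrix},\qquad R_{ABCDEF}=\Psi_{(ABC}{}^{K}\Psi_{DE}{}^{LM}\Psi_{F)KLM},$$ where $\Psi_{ABCD}$ is the Weyl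 spinor. The Petrov type at a point is II, D, N if $\Psi_{ABCD}$ is, respectively, $\alpha_{(A}\alpha_B\beta_C\gamma_{D)}$, $\alpha_{(A}\alpha_B\beta_C\beta_{D)}$ with pairwise non-proportional factors, $\alpha_A\alpha_B\alpha_C\alpha_D\neq0$; it is O if $\Psi_{ABCD}=0$. \textbf{Theorem.} (1) For every solution, at every point of $\Omega$: $(\mathbf k,\mathbf l,\mathbf m,\bar{\mathbf m})$ is a null tetrad, $\Psi_0=\Psi_1=0$, $$\Psi_2=\frac1{12}\Big[Q_{,rr}-\frac2rQ_{,r}+\frac2{r^2}Q\Big]-\frac m{r^3},\qquad \Psi_3=-\frac{\sqrt2P}{4r^2}(K_{,x}-iK_{,y}),$$ $$\Psi_4=\frac1{4r^2}\Big[\{P^2(K_{,x}-iK_{,y})\}_{,x}-i\{P^2(K_{,x}-iK_{,y})\}_{,y}\Big].$$ Moreover $I^3=27J^2$; $R_{011111}=\frac12\Psi_2(2\Psi_3^2-3\Psi_2\Psi_4)$ and $R_{111111}=\Psi_3(2\Psi_3^2-3\Psi_2\Psi_4)$, and all components of $R_{ABCDEF}$ with at most four indices $1$ vanish; and the type is II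 if and only if $IJ\neq0$ and $R_{ABCDEF}\neq0$. (2) The solutions are generally of type II: if $q$ is a charge function of a solution, then replacing $m$ by $m+\varepsilon q^3$ gives a solution for every $\varepsilon\in\mathbb R$, and at each point with $(K_{,x},K_{,y})\neq(0,0)$ its type is II for all but at most two values of $\varepsilon$. Further, suppose that for given $\Lambda$, $\mathcal L$ there is a static spherically symmetric solution on $r\in J_0$, that is, one with $P=1+\frac14(x^2+y^2)$, $Q=f(r)$, $E=E(r)$ and $m$ constant. Then there are a function $P(x,y)$ on a nonempty set $V$ in the $(x,y)$ plane such that $P$, $Q=f(r)$, $E=E(r)$ and any constant $m$ form a solution for the same $\Lambda$, $\mathcal L$ on $\{r\in J_0,\ (x,y)\in V\}$, and at each point of this set it is of type II for all but at most two values of $m$. For $\mathcal L(F)=-F$ and every $\Lambda$ there is a solution on a nonempty $\Omega$ that is of type II at every point. (3) If on $\Omega$ the function $K$ depends on $u$ only (in particular if $K$ is a positive constant), then $\Psi_3=\Psi_4=0$, and the type is D wherever $\Psi_2\neq0$ and O wherever $\Psi_2=0$; if $q$ is a charge function, then at each point the solution with $m+\varepsilon q^3$ in place of $m$ is of type D for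 all but at most one value of $\varepsilon$. (4) No solution is of type N on a nonempty open set. -/

import Mathlib

open scoped ContDiff

noncomputable section

namespace RobinsonTrautman

/-! ### Local Lorentzian geometry on open subsets of `ℝ⁴` -/

/-- Points of the coordinate chart; the coordinates are `(u, r, x, y) = (p 0, p 1, p 2, p 3)`. -/
abbrev Coord : Type := Fin 4 → ℝ

/-- Partial derivative with respect to the `i`-th coordinate. -/
def pd (i : Fin 4) (f : Coord → ℝ) (p : Coord) : ℝ :=
  fderiv ℝ f p (Pi.single i 1)

/-- A field of `4 × 4` matrices, used for metrics in coordinates. -/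
abbrev MetricField : Type := Coord → Matrix (Fin 4) (Fin 4) ℝ

/-- Christoffel symbols `Γ^a_{bc}` of the Levi-Civita connection. -/
def christoffel (g : MetricField) (a b c : Fin 4) (p : Coord) : ℝ :=
  (1 / 2) * ∑ d, (g p)⁻¹ a d *
    (pd b (fun z => g z d c) p + pd c (fun z => g z d b) p - pd d (fun z => g z b c) p)

/-- Riemann tensor `R^a_{bcd} = ∂_c Γ^a_{bd} - ∂_d Γ^a_{bc} + Γ^a_{ce} Γ^e_{bd} - Γ^a_{de} Γ^e_{bc}`. -/
def riemannUp (g : MetricField) (a b c d : Fin 4) (p : Coord) : ℝ :=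
  pd c (christoffel g a b d) p - pd d (christoffel g a b c) p
    + ∑ e, (christoffel g a c e p * christoffel g e b d p
        - christoffel g a d e p * christoffel g e b c p)

/-- Riemann tensor `R_{abcd}` with all indices lowered. -/
def riemann (g : MetricField) (a b c d : Fin 4) (p : Coord) : ℝ :=
  ∑ e, g p a e * riemannUp g e b c d p

/-- Ricci tensor `R_{bd} = R^a_{bad}`. -/
def ricci (g : MetricField) (b d : Fin 4) (p : Coord) : ℝ :=
  ∑ a, riemannUp g a b a d p

/-- Ricci scalar. -/
def scalarCurvature (g : MetricField) (p : Coord) : ℝ :=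
  ∑ a, ∑ b, (g p)⁻¹ a b * ricci g a b p

/-- Mixed Einstein tensor `G^a_b`. -/
def einstein (g : MetricField) (a b : Fin 4) (p : Coord) : ℝ :=
  (∑ c, (g p)⁻¹ a c * ricci g c b p)
    - (1 / 2) * scalarCurvature g p * (if a = b then 1 else 0)

/-- Weyl tensor `C_{abcd}` in dimension four. -/
def weyl (g : MetricField) (a b c d : Fin 4) (p : Coord) : ℝ :=
  riemann g a b c d p
    - (1 / 2) * (g p a c * ricci g b d p - g p a d * ricci g b c p
        - g p b c * ricci g a d p + g p b d * ricci g a c p)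
    + (scalarCurvature g p / 6) * (g p a c * g p b d - g p a d * g p b c)

/-! ### Null tetrads and Weyl scalars -/

/-- Complex bilinear extension of the metric at `p`. -/
def cmetric (g : MetricField) (p : Coord) (v w : Fin 4 → ℂ) : ℂ :=
  ∑ a, ∑ b, (g p a b : ℂ) * v a * w b

/-- `(k, l, m, m̄)` is a null tetrad at `p` for signature `(-,+,+,+)`: `k`, `l` are real, `m̄` is the
complex conjugate of `m`, and the only nonzero products are `g(k,l) = -1` and `g(m,m̄) = 1`. -/
def IsNullTetrad (g : MetricField) (p : Coord) (k l m : Fin 4 → ℂ) : Prop :=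
  star k = k ∧ star l = l ∧
  cmetric g p k k = 0 ∧ cmetric g p l l = 0 ∧ cmetric g p k l = -1 ∧
  cmetric g p m m = 0 ∧ cmetric g p m (star m) = 1 ∧
  cmetric g p k m = 0 ∧ cmetric g p l m = 0

/-- The contraction `C_{abcd} t^a v^b w^c z^d`. -/
def weylContract (g : MetricField) (p : Coord) (t v w z : Fin 4 → ℂ) : ℂ :=
  ∑ a, ∑ b, ∑ c, ∑ d, (weyl g a b c d p : ℂ) * t a * v b * w c * z d

/-- The Weyl scalars `Ψ₀, …, Ψ₄` with respect to a null tetrad: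
`Ψ₀ = C(k,m,k,m)`, `Ψ₁ = C(k,l,k,m)`, `Ψ₂ = C(k,m,m̄,l)`, `Ψ₃ = C(l,k,l,m̄)`, `Ψ₄ = C(l,m̄,l,m̄)`. -/
def weylScalars (g : MetricField) (p : Coord) (k l m : Fin 4 → ℂ) : Fin 5 → ℂ :=
  ![weylContract g p k m k m,
    weylContract g p k l k m,
    weylContract g p k m (star m) l,
    weylContract g p l k l (star m),
    weylContract g p l (star m) l (star m)]

/-! ### Weyl spinors, their invariants and covariants, Petrov types

A Weyl spinor `Ψ_{ABCD}` (totally symmetric) is given by its dyad components `Ψ₀, …, Ψ₄`, where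
`Ψ_n` is the component with exactly `n` indices equal to `1`. -/

/-- The totally symmetric spinor `Ψ_{ABCD}`. -/
def spinor (ψ : Fin 5 → ℂ) (A B C D : Fin 2) : ℂ :=
  ψ ⟨A + B + C + D, by omega⟩

/-- The invariant `I`. -/
def invI (ψ : Fin 5 → ℂ) : ℂ := ψ 0 * ψ 4 - 4 * ψ 1 * ψ 3 + 3 * ψ 2 ^ 2

/-- The invariant `J`. -/
def invJ (ψ : Fin 5 → ℂ) : ℂ :=
  Matrix.det !![ψ 4, ψ 3, ψ 2; ψ 3, ψ 2, ψ 1; ψ 2, ψ 1, ψ 0]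

/-- The skew spinor `ε^{AB}`, with `ε^{01} = 1`; indices are raised by `κ^A = ε^{AB} κ_B`. -/
def eps : Matrix (Fin 2) (Fin 2) ℂ := !![0, 1; -1, 0]

/-- `Ψ_{ABC}{}^K Ψ_{DE}{}^{LM} Ψ_{FKLM}`, with `(A,B,C,D,E,F) = (a 0, …, a 5)`. -/
def sexticProduct (ψ : Fin 5 → ℂ) (a : Fin 6 → Fin 2) : ℂ :=
  ∑ K, ∑ L, ∑ M,
    (∑ K', eps K K' * spinor ψ (a 0) (a 1) (a 2) K') *
    (∑ L', ∑ M', eps L L' * eps M M' * spinor ψ (a 3) (a 4) L' M') *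
    spinor ψ (a 5) K L M

/-- Total symmetrization of a spinor with six indices. The index tuples that arise from `a` by
permutations are those with the same number of entries `1`, each equally often, so the average
over all permutations is the average over these tuples. -/
def symmetrize (T : (Fin 6 → Fin 2) → ℂ) (a : Fin 6 → Fin 2) : ℂ :=
  (∑ b : Fin 6 → Fin 2 with (∑ i, (b i : ℕ)) = ∑ i, (a i : ℕ), T b) /
    (Finset.card {b : Fin 6 → Fin 2 | (∑ i, (b i : ℕ)) = ∑ i, (a i : ℕ)} : ℂ)

/-- The spinor covariant `R_{ABCDEF} = Ψ_{(ABC}{}^K Ψ_{DE}{}^{LM} Ψ_{F)KLM}`. -/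
def covariantR (ψ : Fin 5 → ℂ) : (Fin 6 → Fin 2) → ℂ := symmetrize (sexticProduct ψ)

/-- The binary quartic form `Ψ_{ABCD} ξ^A ξ^B ξ^C ξ^D`. -/
def quartic (ψ : Fin 5 → ℂ) (ξ : Fin 2 → ℂ) : ℂ :=
  ∑ A, ∑ B, ∑ C, ∑ D, spinor ψ A B C D * ξ A * ξ B * ξ C * ξ D

/-- The linear form `α_A ξ^A`. -/
def linForm (α ξ : Fin 2 → ℂ) : ℂ := α 0 * ξ 0 + α 1 * ξ 1

/-- Two one-index spinors are not proportional (in particular both are nonzero). -/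
def NotProp (α β : Fin 2 → ℂ) : Prop := α 0 * β 1 - α 1 * β 0 ≠ 0

/-- Type II: `Ψ_{ABCD} = α_{(A} α_B β_C γ_{D)}` with pairwise non-proportional `α, β, γ`, that is,
one double and two simple principal null directions. -/
def IsTypeII (ψ : Fin 5 → ℂ) : Prop :=
  ∃ α β γ : Fin 2 → ℂ, NotProp α β ∧ NotProp α γ ∧ NotProp β γ ∧
    ∀ ξ, quartic ψ ξ = linForm α ξ ^ 2 * linForm β ξ * linForm γ ξ

/-- Type D: `Ψ_{ABCD} = α_{(A} α_B β_C β_{D)}` with non-proportional `α, β`, that is, two double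
principal null directions. -/
def IsTypeD (ψ : Fin 5 → ℂ) : Prop :=
  ∃ α β : Fin 2 → ℂ, NotProp α β ∧
    ∀ ξ, quartic ψ ξ = linForm α ξ ^ 2 * linForm β ξ ^ 2

/-- Type N: `Ψ_{ABCD} = α_A α_B α_C α_D` with `α ≠ 0`, that is, one quadruple principal null
direction. -/
def IsTypeN (ψ : Fin 5 → ℂ) : Prop :=
  ∃ α : Fin 2 → ℂ, α ≠ 0 ∧ ∀ ξ, quartic ψ ξ = linForm α ξ ^ 4

/-- Type O: the Weyl spinor vanishes. -/
def IsTypeO (ψ : Fin 5 → ℂ) : Prop := ψ = 0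

/-! ### Robinson--Trautman fields with nonlinear electrodynamics -/

/-- The data of the ansatz: cosmological constant `Λ`, Lagrangian `L(F)`, metric functions
`P(u,x,y)`, `m(u)`, `Q(u,r)`, and electric field `E(u,r)`. The conditions they have to satisfy are
in `RTData.IsSolution`. -/
structure RTData where
  /-- cosmological constant -/
  Lam : ℝ
  /-- Lagrangian of nonlinear electrodynamics, a function of `F = F_{μν} F^{μν}` -/
  L : ℝ → ℝ
  /-- `P(u,x,y)` -/
  P : ℝ → ℝ → ℝ → ℝ
  /-- `m(u)` -/
  m : ℝ → ℝ
  /-- `Q(u,r)` -/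
  Q : ℝ → ℝ → ℝ
  /-- `E(u,r)` -/
  E : ℝ → ℝ → ℝ

namespace RTData

variable (S : RTData)

/-- `P` as a function on the chart. -/
def Pf (p : Coord) : ℝ := S.P (p 0) (p 2) (p 3)

/-- `m` as a function on the chart. -/
def mf (p : Coord) : ℝ := S.m (p 0)

/-- `Q` as a function on the chart. -/
def Qf (p : Coord) : ℝ := S.Q (p 0) (p 1)

/-- `E` as a function on the chart. -/
def Ef (p : Coord) : ℝ := S.E (p 0) (p 1)

/-- `ln P` as a function on the chart. -/
def lnP (p : Coord) : ℝ := Real.log (S.Pf p)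

/-- The Gaussian curvature `K = Δ (ln P)`, with `Δ = P² (∂_xx + ∂_yy)`. -/
def K (p : Coord) : ℝ :=
  S.Pf p ^ 2 * (pd 2 (pd 2 S.lnP) p + pd 3 (pd 3 S.lnP) p)

/-- The function `2H = K - 2 r (ln P)_{,u} - 2m/r - (Λ/3) r²`. -/
def twoH (p : Coord) : ℝ :=
  S.K p - 2 * p 1 * pd 0 S.lnP p - 2 * S.mf p / p 1 - S.Lam / 3 * p 1 ^ 2

/-- The metric `ds² = -(2H + Q) du² - 2 du dr + (r²/P²) (dx² + dy²)`. -/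
def metric : MetricField := fun p =>
  !![-(S.twoH p + S.Qf p), -1, 0, 0;
     -1, 0, 0, 0;
     0, 0, p 1 ^ 2 / S.Pf p ^ 2, 0;
     0, 0, 0, p 1 ^ 2 / S.Pf p ^ 2]

/-- The electromagnetic field `F_{μν}` with `F_{ur} = -F_{ru} = E(u,r)`; it is closed since `E`
does not depend on `x, y`. -/
def faraday (p : Coord) : Matrix (Fin 4) (Fin 4) ℝ :=
  !![0, S.Ef p, 0, 0;
     -S.Ef p, 0, 0, 0;
     0, 0, 0, 0;
     0, 0, 0, 0]

/-- `F^{μν}`. -/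
def faradayUp (a b : Fin 4) (p : Coord) : ℝ :=
  ∑ c, ∑ d, (S.metric p)⁻¹ a c * (S.metric p)⁻¹ b d * S.faraday p c d

/-- The invariant `F = F_{μν} F^{μν}`. -/
def emInvariant (p : Coord) : ℝ := ∑ a, ∑ b, S.faraday p a b * S.faradayUp a b p

/-- `L_F = dL/dF` evaluated on the field. -/
def LF (p : Coord) : ℝ := deriv S.L (S.emInvariant p)

/-- `T^a_b = (1/2) (δ^a_b L - 4 F_{bλ} F^{aλ} L_F)`. -/
def stress (a b : Fin 4) (p : Coord) : ℝ :=
  (1 / 2) * ((if a = b then 1 else 0) * S.L (S.emInvariant p)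
    - 4 * (∑ c, S.faraday p b c * S.faradayUp a c p) * S.LF p)

/-- The data form a (smooth) solution of the Einstein equations coupled to nonlinear
electrodynamics on the open set `Ω ⊆ {r > 0}`, with an electromagnetic field and a charge that
vanish nowhere. -/
structure IsSolution (Ω : Set Coord) : Prop where
  isOpen : IsOpen Ω
  r_pos : ∀ p ∈ Ω, 0 < p 1
  P_pos : ∀ p ∈ Ω, 0 < S.Pf p
  smooth_P : ContDiffOn ℝ ∞ S.Pf Ω
  smooth_m : ContDiffOn ℝ ∞ S.mf Ω
  smooth_Q : ContDiffOn ℝ ∞ S.Qf Ω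
  smooth_E : ContDiffOn ℝ ∞ S.Ef Ω
  smooth_L : ∀ p ∈ Ω, ContDiffAt ℝ ∞ S.L (S.emInvariant p)
  E_ne : ∀ p ∈ Ω, S.Ef p ≠ 0
  LF_ne : ∀ p ∈ Ω, S.LF p ≠ 0
  /-- `∂_μ (√(-det g) L_F F^{μν}) = 0` -/
  maxwell : ∀ p ∈ Ω, ∀ b, ∑ a,
    pd a (fun z => Real.sqrt (-(S.metric z).det) * S.LF z * S.faradayUp a b z) p = 0
  /-- `G^a_b = T^a_b - Λ δ^a_b` -/
  einstein_eq : ∀ p ∈ Ω, ∀ a b,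
    einstein S.metric a b p = S.stress a b p - S.Lam * (if a = b then 1 else 0)

/-- The tetrad vector `k = ∂_r`. -/
def kVec (_p : Coord) : Fin 4 → ℂ := ![0, 1, 0, 0]

/-- The tetrad vector `l = ∂_u - (H + Q/2) ∂_r`. -/
def lVec (p : Coord) : Fin 4 → ℂ := ![1, -((S.twoH p / 2 + S.Qf p / 2 : ℝ) : ℂ), 0, 0]

/-- The tetrad vector `m = (P / (√2 r)) (∂_x + i ∂_y)`. -/
def mVec (p : Coord) : Fin 4 → ℂ :=
  ![0, 0, ((S.Pf p / (Real.sqrt 2 * p 1) : ℝ) : ℂ),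
    ((S.Pf p / (Real.sqrt 2 * p 1) : ℝ) : ℂ) * Complex.I]

/-- The Weyl scalars of the metric in the tetrad `(k, l, m)`. -/
def Psi (p : Coord) : Fin 5 → ℂ :=
  weylScalars S.metric p (kVec p) (S.lVec p) (S.mVec p)

/-- `q(u)` is a (smooth) charge function: `|L_F F_{ur}| = q² / r²`. -/
def IsCharge (Ω : Set Coord) (q : ℝ → ℝ) : Prop :=
  ContDiffOn ℝ ∞ (fun p : Coord => q (p 0)) Ω ∧
    ∀ p ∈ Ω, |S.LF p * S.Ef p| = q (p 0) ^ 2 / p 1 ^ 2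

/-- The same data with another function `m(u)`. -/
def withMass (μ : ℝ → ℝ) : RTData := { S with m := μ }

/-- Static data: `P = P(x,y)`, constant `m`, `Q = f(r)`, `E = E(r)`. -/
def static (Lam : ℝ) (L : ℝ → ℝ) (P : ℝ → ℝ → ℝ) (m : ℝ) (f E : ℝ → ℝ) : RTData where
  Lam := Lam
  L := L
  P := fun _ x y => P x y
  m := fun _ => m
  Q := fun _ r => f r
  E := fun _ r => E r

/-- The function `P` of the unit round sphere in stereographic coordinates, for which `K = 1`. -/
def sphereP (x y : ℝ) : ℝ := 1 + (x ^ 2 + y ^ 2) / 4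

end RTData

end RobinsonTrautman

end

/-! Write `A = 2H + Q` and let `c = r² L_F E` be the charge density (`chargeFun`). Since `√(-g) L_F
F^{μν}` has only the entries `∓c / P²` in the `u, r` block, Maxwell's equations say that `c` is
independent of `r` and that `c_u = 2 c (ln P)_u` (`maxwell_iff`). As `c` depends only on `u, r` and
never vanishes, `(ln P)_u = c_u / (2c)` does not depend on `x, y` (`IsSolution.isRegular`). Hence
the `x, y` derivatives of `A` are those of `K`, and `A_r` has none. This simplifies the curvature of
`-A du² - 2 du dr + (r²/P²)(dx² + dy²)` so much that `Ψ₀ = Ψ₁ = 0` and the other Weyl scalars take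
the stated form (`weylScalars_eq`, `Psi_eq`). Einstein's equations reduce to two equations for `Q,
E` alone and one evolution equation containing `K`, `m` and `(ln P)_u` (`isSolution_iff`).

The algebraic part rests on the factorization of the Weyl quartic as `ξ₁² (6Ψ₂ ξ₀² + 4Ψ₃ ξ₀ξ₁ + Ψ₄
ξ₁²)`. Its quadratic factor has discriminant `8D`, where `D = 2Ψ₃² - 3Ψ₂Ψ₄`. Type II therefore means
`Ψ₂ ≠ 0` and `D ≠ 0`. On the other side `I = 3Ψ₂²`, `J = -Ψ₂³`, and every component of the sextic
covariant is a multiple of `D` (`isTypeII_iff`).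

For genericity, `m` enters the evolution equation only through `m_u - 3m (ln P)_u`, and `q³` solves
the homogeneous equation because `q⁴ = c²` (`IsSolution.withMass`). Adding `ε q³` to `m` moves `Ψ₂`
affinely in `ε` with nonzero slope and leaves `Ψ₃, Ψ₄` fixed. When `Ψ₃ ≠ 0`, the conditions `Ψ₂ = 0`
and `D = 0` exclude at most one `ε` each. In the static case the evolution equation is just `(∂_x² +
∂_y²) K = 0`, while the equations for `Q, E` involve neither `P` nor `m`. The sphere can thus be
replaced by `P = x^{3/2}`, for which `K = -3x/2` is harmonic and nonconstant.

Type N on an open set would force `Ψ₃ = 0` there, so `K_x = K_y = 0` there, and then `Ψ₄`, built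
from derivatives of these, vanishes too. -/

open scoped ContDiff

noncomputable section

namespace RobinsonTrautman

/-! ### Calculus of partial derivatives -/

/-- `f` is differentiable at `p` with partial derivatives `v`. -/
structure HasGrad (f : Coord → ℝ) (v : Fin 4 → ℝ) (p : Coord) : Prop where
  diff : DifferentiableAt ℝ f p
  grad : ∀ i, pd i f p = v i

namespace HasGrad

variable {f g : Coord → ℝ} {v w : Fin 4 → ℝ} {p : Coord}

theorem of_eq (h : HasGrad f v p) (hv : ∀ i, v i = w i) : HasGrad f w p :=
  ⟨h.diff, fun i => (h.grad i).trans (hv i)⟩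

theorem const (c : ℝ) (p : Coord) : HasGrad (fun _ => c) (fun _ => 0) p :=
  ⟨differentiableAt_const c, fun i => by simp [pd]⟩

theorem coord (j : Fin 4) (p : Coord) :
    HasGrad (fun z => z j) (fun i => if i = j then 1 else 0) p :=
  ⟨differentiableAt_apply j p, fun i => by
    have h : fderiv ℝ (fun z : Coord => z j) p = ContinuousLinearMap.proj j :=
      (ContinuousLinearMap.proj (R := ℝ) (φ := fun _ : Fin 4 => ℝ) j).fderiv
    simp [pd, h, Pi.single_apply, eq_comm]⟩

theorem neg (hf : HasGrad f v p) : HasGrad (fun z => -f z) (fun i => -v i) p :=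
  ⟨hf.diff.neg, fun i => by simp [pd, fderiv_fun_neg, ← hf.grad]⟩

theorem add (hf : HasGrad f v p) (hg : HasGrad g w p) :
    HasGrad (fun z => f z + g z) (fun i => v i + w i) p :=
  ⟨hf.diff.add hg.diff, fun i => by
    simp [pd, fderiv_fun_add hf.diff hg.diff, ← hf.grad, ← hg.grad]⟩

theorem sub (hf : HasGrad f v p) (hg : HasGrad g w p) :
    HasGrad (fun z => f z - g z) (fun i => v i - w i) p :=
  ⟨hf.diff.sub hg.diff, fun i => by
    simp [pd, fderiv_fun_sub hf.diff hg.diff, ← hf.grad, ← hg.grad]⟩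

theorem mul (hf : HasGrad f v p) (hg : HasGrad g w p) :
    HasGrad (fun z => f z * g z) (fun i => v i * g p + f p * w i) p :=
  ⟨hf.diff.mul hg.diff, fun i => by
    simp [pd, fderiv_fun_mul hf.diff hg.diff, ← hf.grad, ← hg.grad]; ring⟩

theorem comp {φ : ℝ → ℝ} {φ' : ℝ} (hφ : HasDerivAt φ φ' (f p)) (hf : HasGrad f v p) :
    HasGrad (fun z => φ (f z)) (fun i => φ' * v i) p := by
  have h := hφ.comp_hasFDerivAt p hf.diff.hasFDerivAt
  refine ⟨h.differentiableAt, fun i => ?_⟩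
  have h2 : fderiv ℝ (fun z => φ (f z)) p = φ' • fderiv ℝ f p := h.fderiv
  simp [pd, h2, ← hf.grad]

theorem pow (n : ℕ) (hf : HasGrad f v p) :
    HasGrad (fun z => f z ^ n) (fun i => n * f p ^ (n - 1) * v i) p :=
  comp (hasDerivAt_pow n (f p)) hf

theorem inv (hf : HasGrad f v p) (h0 : f p ≠ 0) :
    HasGrad (fun z => (f z)⁻¹) (fun i => -(f p ^ 2)⁻¹ * v i) p :=
  comp (hasDerivAt_inv h0) hf

theorem div (hf : HasGrad f v p) (hg : HasGrad g w p) (h0 : g p ≠ 0) :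
    HasGrad (fun z => f z / g z) (fun i => (v i * g p - f p * w i) / g p ^ 2) p := by
  simp only [div_eq_mul_inv]
  refine (hf.mul (hg.inv h0)).of_eq fun i => ?_
  field_simp
  ring

theorem log (hf : HasGrad f v p) (h0 : f p ≠ 0) :
    HasGrad (fun z => Real.log (f z)) (fun i => v i / f p) p :=
  (comp (Real.hasDerivAt_log h0) hf).of_eq fun i => by rw [inv_mul_eq_div]

end HasGrad

theorem pd_congr {f g : Coord → ℝ} {Ω : Set Coord} (hΩ : IsOpen Ω) (h : ∀ z ∈ Ω, f z = g z)
    {p : Coord} (hp : p ∈ Ω) (i : Fin 4) : pd i f p = pd i g p := by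
  have : f =ᶠ[nhds p] g := by
    filter_upwards [hΩ.mem_nhds hp] with z hz using h z hz
  simp [pd, this.fderiv_eq]

theorem HasGrad.congr {f g : Coord → ℝ} {v : Fin 4 → ℝ} {Ω : Set Coord} (hΩ : IsOpen Ω)
    (h : ∀ z ∈ Ω, f z = g z) {p : Coord} (hp : p ∈ Ω) (hg : HasGrad g v p) : HasGrad f v p := by
  have e : f =ᶠ[nhds p] g := by
    filter_upwards [hΩ.mem_nhds hp] with z hz using h z hz
  exact ⟨hg.diff.congr_of_eventuallyEq e, fun i => (pd_congr hΩ h hp i).trans (hg.grad i)⟩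

theorem pd_eq_zero_of_eqOn_const {f : Coord → ℝ} {Ω : Set Coord} (hΩ : IsOpen Ω) {c : ℝ}
    (h : ∀ z ∈ Ω, f z = c) {p : Coord} (hp : p ∈ Ω) (i : Fin 4) : pd i f p = 0 :=
  (HasGrad.congr hΩ h hp (HasGrad.const c p)).grad i

theorem hasGrad_of_contDiffOn {f : Coord → ℝ} {Ω : Set Coord} (hΩ : IsOpen Ω)
    (hf : ContDiffOn ℝ ∞ f Ω) {p : Coord} (hp : p ∈ Ω) : HasGrad f (fun i => pd i f p) p :=
  ⟨(hf.contDiffAt (hΩ.mem_nhds hp)).differentiableAt (by simp), fun _ => rfl⟩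

theorem contDiffOn_pd {f : Coord → ℝ} {Ω : Set Coord} (hΩ : IsOpen Ω)
    (hf : ContDiffOn ℝ ∞ f Ω) (i : Fin 4) : ContDiffOn ℝ ∞ (pd i f) Ω := by
  have h : ContDiffOn ℝ ∞ (fderiv ℝ f) Ω := hf.fderiv_of_isOpen hΩ (by simp)
  exact h.clm_apply contDiffOn_const

theorem pd_comm {f : Coord → ℝ} {Ω : Set Coord} (hΩ : IsOpen Ω)
    (hf : ContDiffOn ℝ ∞ f Ω) {p : Coord} (hp : p ∈ Ω) (i j : Fin 4) :
    pd i (pd j f) p = pd j (pd i f) p := by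
  have hc : ContDiffAt ℝ ∞ f p := hf.contDiffAt (hΩ.mem_nhds hp)
  have hd : DifferentiableAt ℝ (fderiv ℝ f) p :=
    ((hf.fderiv_of_isOpen hΩ (m := ∞) (by simp)).contDiffAt (hΩ.mem_nhds hp)).differentiableAt
      (by simp)
  have key (i j : Fin 4) : pd i (pd j f) p
      = fderiv ℝ (fderiv ℝ f) p (Pi.single i 1) (Pi.single j 1) := by
    have := fderiv_clm_apply hd (differentiableAt_const (Pi.single j (1 : ℝ) : Coord))
    change fderiv ℝ (fun z => fderiv ℝ f z (Pi.single j 1)) p (Pi.single i 1) = _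
    rw [this]
    simp
  rw [key, key]
  have h2 : (2 : WithTop ℕ∞) ≤ ∞ := WithTop.coe_le_coe.2 le_top
  exact (hc.isSymmSndFDerivAt (by simpa using h2)).eq _ _

/-! ### Curvature of Robinson--Trautman metrics -/

/-- The metric `-A du² - 2 du dr + (r²/P²)(dx² + dy²)`. -/
def rtMetric (A P : Coord → ℝ) : MetricField := fun p =>
  !![-A p, -1, 0, 0;
     -1, 0, 0, 0;
     0, 0, p 1 ^ 2 / P p ^ 2, 0;
     0, 0, 0, p 1 ^ 2 / P p ^ 2]

theorem rtMetric_inv {A P : Coord → ℝ} {p : Coord} (hr : p 1 ≠ 0) (hP : P p ≠ 0) :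
    (rtMetric A P p)⁻¹ =
      !![0, -1, 0, 0;
         -1, A p, 0, 0;
         0, 0, P p ^ 2 / p 1 ^ 2, 0;
         0, 0, 0, P p ^ 2 / p 1 ^ 2] := by
  apply Matrix.inv_eq_right_inv
  ext i j
  fin_cases i <;> fin_cases j <;>
    simp [rtMetric, Matrix.mul_apply, Fin.sum_univ_four] <;> field_simp

theorem rtMetric_det {A P : Coord → ℝ} {p : Coord} :
    (rtMetric A P p).det = -(p 1 ^ 2 / P p ^ 2) ^ 2 := by
  simp [rtMetric, Matrix.det_succ_row_zero, Fin.sum_univ_succ, Fin.succAbove]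
  ring

/-- Functions `A`, `P` that make `rtMetric A P` a smooth metric on the open set `Ω`, with `P`
independent of `r`, with `(ln P)_{,u}` independent of `x, y`, and with `A_{,r}` independent
of `x, y`. -/
structure IsRTPair (A P : Coord → ℝ) (Ω : Set Coord) : Prop where
  isOpen : IsOpen Ω
  r_ne : ∀ p ∈ Ω, p 1 ≠ 0
  P_ne : ∀ p ∈ Ω, P p ≠ 0
  smooth_A : ContDiffOn ℝ ∞ A Ω
  smooth_P : ContDiffOn ℝ ∞ P Ω
  pd_r : ∀ p ∈ Ω, pd 1 P p = 0
  pd_xu : ∀ p ∈ Ω, pd 2 (pd 0 (fun z => Real.log (P z))) p = 0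
  pd_yu : ∀ p ∈ Ω, pd 3 (pd 0 (fun z => Real.log (P z))) p = 0
  pd_xr : ∀ p ∈ Ω, pd 2 (pd 1 A) p = 0
  pd_yr : ∀ p ∈ Ω, pd 3 (pd 1 A) p = 0

/-- The Christoffel symbols `Γ^a_{bc}` of `rtMetric A P`. -/
def rtChristoffel (A P : Coord → ℝ) (a b c : Fin 4) (p : Coord) : ℝ :=
  let l (i : Fin 4) : ℝ := pd i (fun z => Real.log (P z)) p
  (![!![-(1 / 2 * pd 1 A p), 0, 0, 0;
        0, 0, 0, 0;
        0, 0, p 1 / P p ^ 2, 0;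
        0, 0, 0, p 1 / P p ^ 2],
     !![1 / 2 * pd 0 A p + 1 / 2 * (A p * pd 1 A p), 1 / 2 * pd 1 A p, 1 / 2 * pd 2 A p,
          1 / 2 * pd 3 A p;
        1 / 2 * pd 1 A p, 0, 0, 0;
        1 / 2 * pd 2 A p, 0, -(p 1 ^ 2 / P p ^ 2 * l 0 + A p * (p 1 / P p ^ 2)), 0;
        1 / 2 * pd 3 A p, 0, 0, -(p 1 ^ 2 / P p ^ 2 * l 0 + A p * (p 1 / P p ^ 2))],
     !![1 / 2 * (P p ^ 2 / p 1 ^ 2 * pd 2 A p), 0, -l 0, 0;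
        0, 0, (p 1)⁻¹, 0;
        -l 0, (p 1)⁻¹, -l 2, -l 3;
        0, 0, -l 3, l 2],
     !![1 / 2 * (P p ^ 2 / p 1 ^ 2 * pd 3 A p), 0, 0, -l 0;
        0, 0, 0, (p 1)⁻¹;
        0, 0, l 3, -l 2;
        -l 0, (p 1)⁻¹, -l 2, -l 3]] : Fin 4 → Matrix (Fin 4) (Fin 4) ℝ) a b c

namespace IsRTPair

variable {A P : Coord → ℝ} {Ω : Set Coord} (h : IsRTPair A P Ω) {p : Coord}
include h

theorem smooth_log : ContDiffOn ℝ ∞ (fun z => Real.log (P z)) Ω :=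
  h.smooth_P.log h.P_ne

theorem hasGrad_P (hp : p ∈ Ω) :
    HasGrad P (fun i => P p * pd i (fun z => Real.log (P z)) p) p := by
  have hg := hasGrad_of_contDiffOn h.isOpen h.smooth_P hp
  refine hg.of_eq fun i => ?_
  rw [(hg.log (h.P_ne p hp)).grad, mul_div_cancel₀ _ (h.P_ne p hp)]

theorem log_r (hp : p ∈ Ω) : pd 1 (fun z => Real.log (P z)) p = 0 := by
  rw [((hasGrad_of_contDiffOn h.isOpen h.smooth_P hp).log (h.P_ne p hp)).grad, h.pd_r p hp,
    zero_div]

theorem hasGrad_A (hp : p ∈ Ω) : HasGrad A (fun i => pd i A p) p :=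
  hasGrad_of_contDiffOn h.isOpen h.smooth_A hp

theorem hasGrad_pd_A (j : Fin 4) (hp : p ∈ Ω) :
    HasGrad (pd j A) (fun i => pd i (pd j A) p) p :=
  hasGrad_of_contDiffOn h.isOpen (contDiffOn_pd h.isOpen h.smooth_A j) hp

theorem hasGrad_pd_log (j : Fin 4) (hp : p ∈ Ω) :
    HasGrad (pd j (fun z => Real.log (P z))) (fun i => pd i (pd j (fun z => Real.log (P z))) p) p :=
  hasGrad_of_contDiffOn h.isOpen (contDiffOn_pd h.isOpen h.smooth_log j) hp

theorem hasGrad_sq_div_sq (hp : p ∈ Ω) :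
    HasGrad (fun z => z 1 ^ 2 / P z ^ 2) (fun i => p 1 ^ 2 / P p ^ 2 *
      ((if i = 1 then 2 / p 1 else 0) - 2 * pd i (fun z => Real.log (P z)) p)) p := by
  have hP := h.P_ne p hp
  have hr := h.r_ne p hp
  refine (((HasGrad.coord 1 p).pow 2).div ((h.hasGrad_P hp).pow 2) (by positivity)).of_eq
    fun i => ?_
  split_ifs <;> simp <;> field_simp

theorem hasGrad_div_sq (hp : p ∈ Ω) :
    HasGrad (fun z => z 1 / P z ^ 2) (fun i => p 1 / P p ^ 2 *
      ((if i = 1 then 1 / p 1 else 0) - 2 * pd i (fun z => Real.log (P z)) p)) p := by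
  have hP := h.P_ne p hp
  have hr := h.r_ne p hp
  refine ((HasGrad.coord 1 p).div ((h.hasGrad_P hp).pow 2) (by positivity)).of_eq
    fun i => ?_
  split_ifs <;> simp <;> field_simp

theorem hasGrad_sq_div_sq' (hp : p ∈ Ω) :
    HasGrad (fun z => P z ^ 2 / z 1 ^ 2) (fun i => P p ^ 2 / p 1 ^ 2 *
      (2 * pd i (fun z => Real.log (P z)) p - (if i = 1 then 2 / p 1 else 0))) p := by
  have hP := h.P_ne p hp
  have hr := h.r_ne p hp
  refine (((h.hasGrad_P hp).pow 2).div ((HasGrad.coord 1 p).pow 2) (by positivity)).of_eq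
    fun i => ?_
  split_ifs <;> simp <;> field_simp

theorem hasGrad_inv_r (hp : p ∈ Ω) :
    HasGrad (fun z => (z 1)⁻¹) (fun i => if i = 1 then -(p 1 ^ 2)⁻¹ else 0) p :=
  ((HasGrad.coord 1 p).inv (h.r_ne p hp)).of_eq fun i => by split_ifs <;> simp

theorem hasGrad_metric (a b : Fin 4) (hp : p ∈ Ω) :
    HasGrad (fun z => rtMetric A P z a b) (fun i =>
      (!![-pd i A p, 0, 0, 0;
         0, 0, 0, 0;
         0, 0, p 1 ^ 2 / P p ^ 2 * ((if i = 1 then 2 / p 1 else 0)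
          - 2 * pd i (fun z => Real.log (P z)) p), 0;
         0, 0, 0, p 1 ^ 2 / P p ^ 2 * ((if i = 1 then 2 / p 1 else 0)
          - 2 * pd i (fun z => Real.log (P z)) p)] : Matrix (Fin 4) (Fin 4) ℝ) a b) p := by
  fin_cases a <;> fin_cases b <;>
    first
    | exact HasGrad.const _ p
    | exact (h.hasGrad_A hp).neg
    | exact h.hasGrad_sq_div_sq hp

set_option maxHeartbeats 2000000 in
theorem christoffel_eq (a b c : Fin 4) (hp : p ∈ Ω) :
    christoffel (rtMetric A P) a b c p = rtChristoffel A P a b c p := by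
  have hP := h.P_ne p hp
  have hr := h.r_ne p hp
  have e (i a b : Fin 4) := (h.hasGrad_metric a b hp).grad i
  simp only [christoffel, rtMetric_inv hr hP, e, Fin.sum_univ_four]
  fin_cases a <;> fin_cases b <;> fin_cases c <;>
    simp [rtChristoffel, h.log_r hp] <;> field_simp <;> ring

end IsRTPair

/-- The partial derivatives `∂_i Γ^a_{bc}` for `rtMetric A P`. -/
def rtChristoffelGrad (A P : Coord → ℝ) (i a b c : Fin 4) (p : Coord) : ℝ :=
  let L : Coord → ℝ := fun z => Real.log (P z)
  let β : ℝ := p 1 / P p ^ 2 * ((if i = 1 then 1 / p 1 else 0) - 2 * pd i L p)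
  let γ : ℝ := -((p 1 ^ 2 / P p ^ 2 * ((if i = 1 then 2 / p 1 else 0) - 2 * pd i L p)) * pd 0 L p
      + p 1 ^ 2 / P p ^ 2 * pd i (pd 0 L) p + (pd i A p * (p 1 / P p ^ 2) + A p * β))
  let δ (j : Fin 4) : ℝ := 1 / 2 * ((P p ^ 2 / p 1 ^ 2 *
      (2 * pd i L p - (if i = 1 then 2 / p 1 else 0))) * pd j A p
      + P p ^ 2 / p 1 ^ 2 * pd i (pd j A) p)
  let ρ : ℝ := if i = 1 then -(p 1 ^ 2)⁻¹ else 0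
  let a1 (j : Fin 4) : ℝ := 1 / 2 * pd i (pd j A) p
  let l (j : Fin 4) : ℝ := pd i (pd j L) p
  (![!![-a1 1, 0, 0, 0;
        0, 0, 0, 0;
        0, 0, β, 0;
        0, 0, 0, β],
     !![a1 0 + 1 / 2 * (pd i A p * pd 1 A p + A p * pd i (pd 1 A) p), a1 1, a1 2, a1 3;
        a1 1, 0, 0, 0;
        a1 2, 0, γ, 0;
        a1 3, 0, 0, γ],
     !![δ 2, 0, -l 0, 0;
        0, 0, ρ, 0;
        -l 0, ρ, -l 2, -l 3;
        0, 0, -l 3, l 2],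
     !![δ 3, 0, 0, -l 0;
        0, 0, 0, ρ;
        0, 0, l 3, -l 2;
        -l 0, ρ, -l 2, -l 3]] : Fin 4 → Matrix (Fin 4) (Fin 4) ℝ) a b c

/-! ### Riemann and Ricci tensors of `rtMetric` -/

namespace IsRTPair

variable {A P : Coord → ℝ} {Ω : Set Coord} (h : IsRTPair A P Ω) {p : Coord}
include h

theorem hasGrad_rtChristoffel (a b c : Fin 4) (hp : p ∈ Ω) :
    HasGrad (rtChristoffel A P a b c) (fun i => rtChristoffelGrad A P i a b c p) p := by
  have hh (j : Fin 4) : HasGrad (fun z => 1 / 2 * pd j A z)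
      (fun i => 1 / 2 * pd i (pd j A) p) p :=
    ((HasGrad.const (1 / 2) p).mul (h.hasGrad_pd_A j hp)).of_eq fun i => by ring
  have hu : HasGrad (fun z => 1 / 2 * pd 0 A z + 1 / 2 * (A z * pd 1 A z))
      (fun i => 1 / 2 * pd i (pd 0 A) p + 1 / 2 * (pd i A p * pd 1 A p + A p * pd i (pd 1 A) p))
      p :=
    ((hh 0).add ((HasGrad.const (1 / 2) p).mul ((h.hasGrad_A hp).mul
      (h.hasGrad_pd_A 1 hp)))).of_eq fun i => by ring
  have hx (j : Fin 4) : HasGrad (fun z => 1 / 2 * (P z ^ 2 / z 1 ^ 2 * pd j A z))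
      (fun i => 1 / 2 * ((P p ^ 2 / p 1 ^ 2 *
        (2 * pd i (fun z => Real.log (P z)) p - (if i = 1 then 2 / p 1 else 0))) * pd j A p
        + P p ^ 2 / p 1 ^ 2 * pd i (pd j A) p)) p :=
    ((HasGrad.const (1 / 2) p).mul ((h.hasGrad_sq_div_sq' hp).mul
      (h.hasGrad_pd_A j hp))).of_eq fun i => by ring
  have hxx := (((h.hasGrad_sq_div_sq hp).mul (h.hasGrad_pd_log 0 hp)).add
    ((h.hasGrad_A hp).mul (h.hasGrad_div_sq hp))).neg
  fin_cases a <;> fin_cases b <;> fin_cases c <;>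
    first
    | exact HasGrad.const _ p
    | exact h.hasGrad_div_sq hp
    | exact h.hasGrad_inv_r hp
    | exact h.hasGrad_pd_log _ hp
    | exact (h.hasGrad_pd_log _ hp).neg
    | exact hh _
    | exact (hh _).neg
    | exact hu
    | exact hx _
    | exact hxx

/-- The closed form of the Christoffel symbols holds on the whole open set `Ω`, not only at `p`, so
it may be differentiated. -/
theorem riemannUp_eq (a b c d : Fin 4) (hp : p ∈ Ω) :
    riemannUp (rtMetric A P) a b c d p =
      rtChristoffelGrad A P c a b d p - rtChristoffelGrad A P d a b c p
      + ∑ e, (rtChristoffel A P a c e p * rtChristoffel A P e b d p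
          - rtChristoffel A P a d e p * rtChristoffel A P e b c p) := by
  have e (a b c i : Fin 4) : pd i (christoffel (rtMetric A P) a b c) p
      = rtChristoffelGrad A P i a b c p :=
    ((h.hasGrad_rtChristoffel a b c hp).congr h.isOpen
      (fun z hz => h.christoffel_eq a b c hz) hp).grad i
  simp only [riemannUp, e, h.christoffel_eq _ _ _ hp]

theorem log_xr (i : Fin 4) (hp : p ∈ Ω) : pd i (pd 1 (fun z => Real.log (P z))) p = 0 :=
  pd_eq_zero_of_eqOn_const h.isOpen (fun _ hz => h.log_r hz) hp i

theorem log_comm (i j : Fin 4) (hp : p ∈ Ω) :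
    pd i (pd j (fun z => Real.log (P z))) p = pd j (pd i (fun z => Real.log (P z))) p :=
  pd_comm h.isOpen h.smooth_log hp i j

theorem A_comm (i j : Fin 4) (hp : p ∈ Ω) : pd i (pd j A) p = pd j (pd i A) p :=
  pd_comm h.isOpen h.smooth_A hp i j

set_option maxHeartbeats 4000000 in
-- The hypotheses on the mixed derivatives of `ln P` and `A`, together with symmetry of second
-- derivatives, remove the components mixing `u, r` with `x, y`. The `x, y` block is a multiple of
-- the identity because the transverse metric is conformally flat.
theorem ricci_eq (a b : Fin 4) (hp : p ∈ Ω) :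
    ricci (rtMetric A P) a b p =
      (let L : Coord → ℝ := fun z => Real.log (P z)
       let α : ℝ := pd 1 A p / p 1 + pd 1 (pd 1 A) p / 2 + 2 * pd 0 L p / p 1
       let β : ℝ := pd 2 (pd 2 L) p + pd 3 (pd 3 L) p
        - p 1 ^ 2 / P p ^ 2 * (A p / p 1 ^ 2 + pd 1 A p / p 1 + 4 * pd 0 L p / p 1)
       !![A p * pd 1 A p / p 1 + A p * pd 1 (pd 1 A) p / 2 + pd 1 A p * pd 0 L p + pd 0 A p / p 1
            + P p ^ 2 / p 1 ^ 2 * (pd 2 (pd 2 A) p + pd 3 (pd 3 A) p) / 2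
            - 2 * pd 0 L p ^ 2 + 2 * pd 0 (pd 0 L) p, α, 0, 0;
          α, 0, 0, 0;
          0, 0, β, 0;
          0, 0, 0, β] a b) := by
  have hP := h.P_ne p hp
  have hr := h.r_ne p hp
  have e1 := h.log_xr (hp := hp)
  have e2 (i : Fin 4) := (h.log_comm 1 i hp).trans (e1 i)
  have e3 := h.pd_xu p hp
  have e4 := h.pd_yu p hp
  have e5 := (h.log_comm 0 2 hp).trans e3
  have e6 := (h.log_comm 0 3 hp).trans e4
  have e7 := h.pd_xr p hp
  have e8 := h.pd_yr p hp
  have e9 := (h.A_comm 1 2 hp).trans e7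
  have e10 := (h.A_comm 1 3 hp).trans e8
  have e11 := h.A_comm 1 0 hp
  have e12 := h.A_comm 2 0 hp
  have e13 := h.A_comm 3 0 hp
  have e14 := h.A_comm 3 2 hp
  have e15 := h.log_comm 3 2 hp
  have e0 := h.log_r hp
  simp only [ricci, h.riemannUp_eq _ _ _ _ hp, Fin.sum_univ_four]
  fin_cases a <;> fin_cases b <;>
    simp [rtChristoffel, rtChristoffelGrad, e0, e2, e3, e4, e5, e6, e7, e8, e9, e10, e11, e12,
      e13, e14, e15] <;> field_simp <;> ring

end IsRTPair

/-! ### Scalar curvature and Einstein tensor -/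

namespace IsRTPair

variable {A P : Coord → ℝ} {Ω : Set Coord} (h : IsRTPair A P Ω) {p : Coord}
include h

set_option maxHeartbeats 1000000 in
theorem scalarCurvature_eq (hp : p ∈ Ω) :
    scalarCurvature (rtMetric A P) p =
      (let L : Coord → ℝ := fun z => Real.log (P z)
       2 * (P p ^ 2 / p 1 ^ 2) * (pd 2 (pd 2 L) p + pd 3 (pd 3 L) p)
        - 2 * A p / p 1 ^ 2 - 4 * pd 1 A p / p 1 - pd 1 (pd 1 A) p - 12 * pd 0 L p / p 1) := by
  have hP := h.P_ne p hp
  have hr := h.r_ne p hp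
  simp only [scalarCurvature, h.ricci_eq _ _ hp, rtMetric_inv hr hP, Fin.sum_univ_four]
  simp
  field_simp
  ring

set_option maxHeartbeats 1000000 in
theorem einstein_eq (a b : Fin 4) (hp : p ∈ Ω) :
    einstein (rtMetric A P) a b p =
      (let L : Coord → ℝ := fun z => Real.log (P z)
       let α : ℝ := A p / p 1 ^ 2 + pd 1 A p / p 1
        - P p ^ 2 / p 1 ^ 2 * (pd 2 (pd 2 L) p + pd 3 (pd 3 L) p) + 4 * pd 0 L p / p 1
       let β : ℝ := pd 1 A p / p 1 + pd 1 (pd 1 A) p / 2 + 2 * pd 0 L p / p 1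
       !![α, 0, 0, 0;
          2 * A p * pd 0 L p / p 1 - pd 1 A p * pd 0 L p - pd 0 A p / p 1
            - P p ^ 2 / p 1 ^ 2 * (pd 2 (pd 2 A) p + pd 3 (pd 3 A) p) / 2
            + 2 * pd 0 L p ^ 2 - 2 * pd 0 (pd 0 L) p, α, 0, 0;
          0, 0, β, 0;
          0, 0, 0, β] a b) := by
  have hP := h.P_ne p hp
  have hr := h.r_ne p hp
  simp only [einstein, h.scalarCurvature_eq hp, h.ricci_eq _ _ hp, rtMetric_inv hr hP,
    Fin.sum_univ_four]
  fin_cases a <;> fin_cases b <;> simp <;> field_simp <;> ring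

end IsRTPair

/-! ### Weyl tensor components and Weyl scalars -/

theorem weyl_antisymm (g : MetricField) (a b c d : Fin 4) (p : Coord) :
    weyl g a b d c p = -weyl g a b c d p := by
  have e (x : Fin 4) : riemannUp g x b d c p = -riemannUp g x b c d p := by
    simp only [riemannUp, Finset.sum_sub_distrib]
    ring
  have e' : riemann g a b d c p = -riemann g a b c d p := by
    simp only [riemann, e, mul_neg, Finset.sum_neg_distrib]
  simp only [weyl, e']
  ring

namespace IsRTPair

variable {A P : Coord → ℝ} {Ω : Set Coord} (h : IsRTPair A P Ω) {p : Coord}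
include h

set_option maxHeartbeats 4000000 in
-- The trace part `w` over `x, y` carries `Ψ₂` and the trace-free part `σ, τ` carries `Ψ₄`.
-- Contracting twice with `l = ∂_u - (A/2) ∂_r` cancels the terms `-A w` against those from the `ur`
-- entries.
theorem weyl_transverse_eq (s t X Y : Fin 2) (hp : p ∈ Ω) :
    weyl (rtMetric A P) (![0, 1] s) (![2, 3] X) (![0, 1] t) (![2, 3] Y) p =
      (let L : Coord → ℝ := fun z => Real.log (P z)
       let w : ℝ := 1 / 12 * (p 1 ^ 2 / P p ^ 2 * (pd 1 (pd 1 A) p - 2 / p 1 * pd 1 A p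
         + 2 / p 1 ^ 2 * A p) - 2 * (pd 2 (pd 2 L) p + pd 3 (pd 3 L) p))
       let σ : ℝ := 1 / 4 * (pd 2 (pd 2 A) p - pd 3 (pd 3 A) p
         + 2 * (pd 2 L p * pd 2 A p - pd 3 L p * pd 3 A p))
       let τ : ℝ := 1 / 2 * (pd 2 (pd 3 A) p + pd 3 L p * pd 2 A p + pd 2 L p * pd 3 A p)
       (!![!![-A p * w + σ, τ; τ, -A p * w - σ], !![-w, 0; 0, -w];
         !![-w, 0; 0, -w], 0] : Matrix (Fin 2) (Fin 2) (Matrix (Fin 2) (Fin 2) ℝ)) s t X Y) := by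
  have hP := h.P_ne p hp
  have hr := h.r_ne p hp
  have e1 := h.log_xr (hp := hp)
  have e2 (i : Fin 4) := (h.log_comm 1 i hp).trans (e1 i)
  have e3 := h.pd_xu p hp
  have e4 := h.pd_yu p hp
  have e5 := (h.log_comm 0 2 hp).trans e3
  have e6 := (h.log_comm 0 3 hp).trans e4
  have e7 := h.pd_xr p hp
  have e8 := h.pd_yr p hp
  have e9 := (h.A_comm 1 2 hp).trans e7
  have e10 := (h.A_comm 1 3 hp).trans e8
  have e11 := h.A_comm 1 0 hp
  have e12 := h.A_comm 2 0 hp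
  have e13 := h.A_comm 3 0 hp
  have e14 := h.A_comm 3 2 hp
  have e15 := h.log_comm 3 2 hp
  have e0 := h.log_r hp
  simp only [weyl, riemann, h.scalarCurvature_eq hp, h.ricci_eq _ _ hp]
  fin_cases s <;> fin_cases t <;> fin_cases X <;> fin_cases Y <;>
    simp [rtMetric, h.riemannUp_eq _ _ _ _ hp, Fin.sum_univ_four, rtChristoffel,
      rtChristoffelGrad, e0, e2, e3, e4, e5, e6, e7, e8, e9, e10, e11, e12,
      e13, e14, e15] <;> (try field_simp) <;> ring1

set_option maxHeartbeats 4000000 in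
-- These are the components needed for `Ψ₁` and `Ψ₃`. Only `C_{urux}` and `C_{uruy}` survive, so
-- `Ψ₁` vanishes and `Ψ₃` is the `x, y` gradient of `A`.
theorem weyl_longitudinal_eq (s t X : Fin 2) (hp : p ∈ Ω) :
    weyl (rtMetric A P) (![0, 1] s) 1 (![0, 1] t) (![2, 3] X) p =
      (!![![-(pd 2 A p) / (2 * p 1), -(pd 3 A p) / (2 * p 1)], 0; 0, 0] :
        Matrix (Fin 2) (Fin 2) (Fin 2 → ℝ)) s t X ∧
    weyl (rtMetric A P) 1 0 1 (![2, 3] X) p = 0 := by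
  have hP := h.P_ne p hp
  have hr := h.r_ne p hp
  have e1 := h.log_xr (hp := hp)
  have e2 (i : Fin 4) := (h.log_comm 1 i hp).trans (e1 i)
  have e3 := h.pd_xu p hp
  have e4 := h.pd_yu p hp
  have e5 := (h.log_comm 0 2 hp).trans e3
  have e6 := (h.log_comm 0 3 hp).trans e4
  have e7 := h.pd_xr p hp
  have e8 := h.pd_yr p hp
  have e9 := (h.A_comm 1 2 hp).trans e7
  have e10 := (h.A_comm 1 3 hp).trans e8
  have e11 := h.A_comm 1 0 hp
  have e12 := h.A_comm 2 0 hp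
  have e13 := h.A_comm 3 0 hp
  have e14 := h.A_comm 3 2 hp
  have e15 := h.log_comm 3 2 hp
  have e0 := h.log_r hp
  simp only [weyl, riemann, h.scalarCurvature_eq hp, h.ricci_eq _ _ hp]
  fin_cases s <;> fin_cases t <;> fin_cases X <;>
    simp [rtMetric, h.riemannUp_eq _ _ _ _ hp, Fin.sum_univ_four, rtChristoffel,
      rtChristoffelGrad, e0, e2, e3, e4, e5, e6, e7, e8, e9, e10, e11, e12,
      e13, e14, e15] <;> field_simp

end IsRTPair

theorem weylContract_transverse (g : MetricField) (p : Coord) (a b c d : Fin 2 → ℂ) :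
    weylContract g p ![a 0, a 1, 0, 0] ![0, 0, b 0, b 1] ![c 0, c 1, 0, 0] ![0, 0, d 0, d 1] =
      ∑ s, ∑ X, ∑ t, ∑ Y, (weyl g (![0, 1] s) (![2, 3] X) (![0, 1] t) (![2, 3] Y) p : ℂ) *
        a s * b X * c t * d Y := by
  simp [weylContract, Fin.sum_univ_four]

theorem weylContract_longitudinal (g : MetricField) (p : Coord) (a b c d : Fin 2 → ℂ) :
    weylContract g p ![a 0, a 1, 0, 0] ![b 0, b 1, 0, 0] ![c 0, c 1, 0, 0] ![0, 0, d 0, d 1] =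
      ∑ s, ∑ X, ∑ t, ∑ Y, (weyl g (![0, 1] s) (![0, 1] X) (![0, 1] t) (![2, 3] Y) p : ℂ) *
        a s * b X * c t * d Y := by
  simp [weylContract, Fin.sum_univ_four]

theorem weylContract_swap (g : MetricField) (p : Coord) (t v w z : Fin 4 → ℂ) :
    weylContract g p t v z w = -weylContract g p t v w z := by
  simp only [weylContract, ← Finset.sum_neg_distrib]
  refine Finset.sum_congr rfl fun a _ => Finset.sum_congr rfl fun b _ => ?_
  rw [Finset.sum_comm]
  refine Finset.sum_congr rfl fun c _ => Finset.sum_congr rfl fun d _ => ?_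
  rw [weyl_antisymm]
  push_cast
  ring

theorem sq_tetrad_coeff (a r : ℝ) : (a / (Real.sqrt 2 * r)) ^ 2 = a ^ 2 / (2 * r ^ 2) := by
  rw [div_pow, mul_pow, Real.sq_sqrt (by norm_num)]

namespace IsRTPair

variable {A P : Coord → ℝ} {Ω : Set Coord} (h : IsRTPair A P Ω) {p : Coord}
include h

theorem isNullTetrad (hp : p ∈ Ω) :
    IsNullTetrad (rtMetric A P) p ![0, 1, 0, 0] ![1, -((A p / 2 : ℝ) : ℂ), 0, 0]
      ![0, 0, ((P p / (Real.sqrt 2 * p 1) : ℝ) : ℂ),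
        ((P p / (Real.sqrt 2 * p 1) : ℝ) : ℂ) * Complex.I] := by
  have hP := h.P_ne p hp
  have hr := h.r_ne p hp
  have hμ := sq_tetrad_coeff (P p) (p 1)
  set μ := P p / (Real.sqrt 2 * p 1) with hμ'
  have hμ2 : 2 * ((p 1 : ℂ) ^ 2 / (P p : ℂ) ^ 2 * (μ : ℂ) ^ 2) = 1 := by
    have : 2 * (p 1 ^ 2 / P p ^ 2 * μ ^ 2) = 1 := by rw [hμ]; field_simp
    exact_mod_cast this
  clear_value μ
  refine ⟨?_, ?_, ?_, ?_, ?_, ?_, ?_, ?_, ?_⟩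
  · ext i; fin_cases i <;> simp
  · ext i; fin_cases i <;> simp
  · simp [cmetric, Fin.sum_univ_four, rtMetric]
  · simp [cmetric, Fin.sum_univ_four, rtMetric]; ring
  · simp [cmetric, Fin.sum_univ_four, rtMetric]
  · simp [cmetric, Fin.sum_univ_four, rtMetric]
    linear_combination (p 1 : ℂ) ^ 2 / (P p : ℂ) ^ 2 * (μ : ℂ) ^ 2 * Complex.I_sq
  · simp [cmetric, Fin.sum_univ_four, rtMetric]
    linear_combination hμ2 - (p 1 : ℂ) ^ 2 / (P p : ℂ) ^ 2 * (μ : ℂ) ^ 2 * Complex.I_sq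
  · simp [cmetric, Fin.sum_univ_four, rtMetric]
  · simp [cmetric, Fin.sum_univ_four, rtMetric]

theorem weylScalars_eq (hp : p ∈ Ω) :
    weylScalars (rtMetric A P) p ![0, 1, 0, 0] ![1, -((A p / 2 : ℝ) : ℂ), 0, 0]
      ![0, 0, ((P p / (Real.sqrt 2 * p 1) : ℝ) : ℂ),
        ((P p / (Real.sqrt 2 * p 1) : ℝ) : ℂ) * Complex.I] =
      (let L : Coord → ℝ := fun z => Real.log (P z)
       ![0, 0,
        ((1 / 12 * (pd 1 (pd 1 A) p - 2 / p 1 * pd 1 A p + 2 / p 1 ^ 2 * A p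
          - 2 * (P p ^ 2 / p 1 ^ 2 * (pd 2 (pd 2 L) p + pd 3 (pd 3 L) p))) : ℝ) : ℂ),
        -((Real.sqrt 2 * P p / (4 * p 1 ^ 2) : ℝ) : ℂ) *
            ((pd 2 A p : ℂ) - Complex.I * (pd 3 A p : ℂ)),
        ((P p ^ 2 / (4 * p 1 ^ 2) : ℝ) : ℂ) *
          (((pd 2 (pd 2 A) p - pd 3 (pd 3 A) p
             + 2 * (pd 2 L p * pd 2 A p - pd 3 L p * pd 3 A p) : ℝ) : ℂ)
           - Complex.I * ((2 * (pd 2 (pd 3 A) p + pd 3 L p * pd 2 A p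
             + pd 2 L p * pd 3 A p) : ℝ) : ℂ))]) := by
  have hP := h.P_ne p hp
  have hr := h.r_ne p hp
  have hμ := sq_tetrad_coeff (P p) (p 1)
  have hs : (√2 : ℝ) ≠ 0 := by positivity
  -- The prefactor of `Ψ₃`: one factor `P / (√2 r)` from the tetrad and `1 / (2r)` from the Weyl
  -- component.
  have hμ1 : P p / (√2 * p 1) * (1 / (2 * p 1)) = √2 * P p / (4 * p 1 ^ 2) := by
    have : (√2 : ℝ) ^ 2 = 2 := Real.sq_sqrt (by norm_num)
    field_simp
    linear_combination -2 * this
  set μ := P p / (Real.sqrt 2 * p 1) with hμ'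
  have hμ2 : (μ : ℂ) ^ 2 = (P p : ℂ) ^ 2 / (2 * (p 1 : ℂ) ^ 2) := by exact_mod_cast hμ
  have hμ1C : (μ : ℂ) * (1 / (2 * (p 1 : ℂ)))
      = (√2 : ℝ) * (P p : ℂ) / (4 * (p 1 : ℂ) ^ 2) := by exact_mod_cast hμ1
  have hrC : (p 1 : ℂ) ≠ 0 := by exact_mod_cast hr
  have hPC : (P p : ℂ) ≠ 0 := by exact_mod_cast hP
  have hI := Complex.I_sq
  have hT (a b c d : Fin 2 → ℂ) := weylContract_transverse (rtMetric A P) p a b c d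
  have hL (a b c d : Fin 2 → ℂ) := weylContract_longitudinal (rtMetric A P) p a b c d
  have hk : ![0, 1, 0, 0] = ![(![0, 1] : Fin 2 → ℂ) 0, (![0, 1] : Fin 2 → ℂ) 1, 0, 0] := rfl
  have hl : ![1, -((A p / 2 : ℝ) : ℂ), 0, 0] = ![(![1, -((A p / 2 : ℝ) : ℂ)] : Fin 2 → ℂ) 0,
    (![1, -((A p / 2 : ℝ) : ℂ)] : Fin 2 → ℂ) 1, 0, 0] := rfl
  have hm : ![0, 0, (μ : ℂ), (μ : ℂ) * Complex.I] = ![0, 0,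
    (![(μ : ℂ), (μ : ℂ) * Complex.I] : Fin 2 → ℂ) 0,
    (![(μ : ℂ), (μ : ℂ) * Complex.I] : Fin 2 → ℂ) 1] := rfl
  have hm' : star ![0, 0, (μ : ℂ), (μ : ℂ) * Complex.I] = ![0, 0,
    (![(μ : ℂ), -((μ : ℂ) * Complex.I)] : Fin 2 → ℂ) 0,
    (![(μ : ℂ), -((μ : ℂ) * Complex.I)] : Fin 2 → ℂ) 1] := by
    ext i; fin_cases i <;> simp
  have hlong (s t X : Fin 2) : weyl (rtMetric A P) (![0, 1] s) (![0, 1] 1) (![0, 1] t)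
      (![2, 3] X) p = _ := (h.weyl_longitudinal_eq s t X hp).1
  have hlong' (X : Fin 2) : weyl (rtMetric A P) (![0, 1] 1) (![0, 1] 0) (![0, 1] 1)
      (![2, 3] X) p = _ := (h.weyl_longitudinal_eq 0 0 X hp).2
  have htr (s t X Y : Fin 2) := h.weyl_transverse_eq s t X Y hp
  unfold weylScalars
  -- `Ψ₂ = C(k, m, m̄, l)` has its last two slots in the order opposite to that of the transverse
  -- block, hence the swap.
  rw [hm', hk, hl, hm, weylContract_swap _ _ _ _ ![_, _, 0, 0], hT, hT, hT, hL, hL]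
  simp only [htr, hlong, hlong', Fin.sum_univ_two]
  ext n
  fin_cases n
  · simp
  · simp
  · simp
    linear_combination (norm := skip)
      (12⁻¹ * ((p 1 : ℂ) ^ 2 / (P p : ℂ) ^ 2 * ((pd 1 (pd 1 A) p : ℂ) - 2 / (p 1 : ℂ) * (pd 1 A p : ℂ)
        + 2 / (p 1 : ℂ) ^ 2 * (A p : ℂ)) - 2 * ((pd 2 (pd 2 fun z => Real.log (P z)) p : ℂ)
        + (pd 3 (pd 3 fun z => Real.log (P z)) p : ℂ)))) * (2 * hμ2 - (μ : ℂ) ^ 2 * hI)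
    field_simp
    ring
  · simp
    linear_combination -((pd 2 A p : ℂ) - Complex.I * (pd 3 A p : ℂ)) * hμ1C
  · simp
    linear_combination
      (4⁻¹ * ((pd 2 (pd 2 A) p : ℂ) - (pd 3 (pd 3 A) p : ℂ)
        + 2 * ((pd 2 (fun z => Real.log (P z)) p : ℂ) * (pd 2 A p : ℂ)
          - (pd 3 (fun z => Real.log (P z)) p : ℂ) * (pd 3 A p : ℂ)))) *
        (2 * hμ2 - (μ : ℂ) ^ 2 * hI)
      - Complex.I * ((pd 2 (pd 3 A) p : ℂ) + (pd 3 (fun z => Real.log (P z)) p : ℂ) * (pd 2 A p : ℂ)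
        + (pd 2 (fun z => Real.log (P z)) p : ℂ) * (pd 3 A p : ℂ)) * hμ2

end IsRTPair

/-- No regularity is required: where `f` is not differentiable, `fderiv` is zero by convention. -/
theorem pd_eq_zero_of_line {f : Coord → ℝ} {p : Coord} {i : Fin 4}
    (h : ∀ t : ℝ, f (p + t • Pi.single i 1) = f p) : pd i f p = 0 := by
  by_cases hd : DifferentiableAt ℝ f p
  · rw [pd, ← hd.lineDeriv_eq_fderiv, lineDeriv]
    simp [h]
  · simp [pd, fderiv_zero_of_not_differentiableAt hd]

/-! ### Curvature of the Robinson–Trautman ansatz -/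

namespace RTData

variable {S : RTData} {Ω : Set Coord} {p : Coord}

theorem pd_Pf_r : pd 1 S.Pf p = 0 := pd_eq_zero_of_line fun t => by simp [Pf]

theorem pd_mf {i : Fin 4} (hi : i ≠ 0) : pd i S.mf p = 0 :=
  pd_eq_zero_of_line fun t => by simp [mf, hi.symm]

theorem pd_Qf {i : Fin 4} (hi : i ≠ 0) (hi' : i ≠ 1) : pd i S.Qf p = 0 :=
  pd_eq_zero_of_line fun t => by simp [Qf, hi.symm, hi'.symm]

theorem pd_lnP_r : pd 1 S.lnP p = 0 :=
  pd_eq_zero_of_line fun t => by simp [lnP, Pf]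

/-- `P` is invariant under translations in `r`, and partial differentiation commutes with
translations, so `K` is invariant as well. Smoothness plays no role. -/
theorem pd_K_r : pd 1 S.K p = 0 := by
  refine pd_eq_zero_of_line fun t => ?_
  have hl (z : Coord) : S.lnP (z + t • Pi.single 1 1) = S.lnP z := by simp [lnP, Pf]
  have key (f : Coord → ℝ) (hf : ∀ z, f (z + t • Pi.single 1 1) = f z) (i : Fin 4) (z : Coord) :
      pd i f (z + t • Pi.single 1 1) = pd i f z := by
    have : (fun z => f (z + t • Pi.single 1 1)) = f := funext hf
    conv_rhs => rw [← this]
    simp only [pd, fderiv_comp_add_right]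
  rw [K, K, key _ (key _ hl 2), key _ (key _ hl 3)]
  simp [Pf]

theorem smooth_r (Ω : Set Coord) : ContDiffOn ℝ ∞ (fun p : Coord => p 1) Ω :=
  (contDiff_apply ℝ ℝ (1 : Fin 4)).contDiffOn

variable (S) in
/-- The function `-g_{uu} = 2H + Q`. -/
def Af (p : Coord) : ℝ := S.twoH p + S.Qf p

/-- The metric functions are smooth, and `(ln P)_{,u}` does not depend on `x, y`. -/
structure IsRegular (S : RTData) (Ω : Set Coord) : Prop where
  isOpen : IsOpen Ω
  r_pos : ∀ p ∈ Ω, 0 < p 1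
  P_pos : ∀ p ∈ Ω, 0 < S.Pf p
  smooth_P : ContDiffOn ℝ ∞ S.Pf Ω
  smooth_m : ContDiffOn ℝ ∞ S.mf Ω
  smooth_Q : ContDiffOn ℝ ∞ S.Qf Ω
  pd_xu : ∀ p ∈ Ω, pd 2 (pd 0 S.lnP) p = 0
  pd_yu : ∀ p ∈ Ω, pd 3 (pd 0 S.lnP) p = 0

namespace IsRegular

variable (h : S.IsRegular Ω)
include h

theorem smooth_lnP : ContDiffOn ℝ ∞ S.lnP Ω :=
  h.smooth_P.log fun p hp => (h.P_pos p hp).ne'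

theorem smooth_K : ContDiffOn ℝ ∞ S.K Ω :=
  (h.smooth_P.pow 2).mul
    ((contDiffOn_pd h.isOpen (contDiffOn_pd h.isOpen h.smooth_lnP 2) 2).add
      (contDiffOn_pd h.isOpen (contDiffOn_pd h.isOpen h.smooth_lnP 3) 3))

theorem smooth_Af : ContDiffOn ℝ ∞ S.Af Ω := by
  have h0 := contDiffOn_pd h.isOpen h.smooth_lnP 0
  have hr := smooth_r Ω
  exact (((h.smooth_K.sub ((contDiffOn_const.mul hr).mul h0)).sub
    ((contDiffOn_const.mul h.smooth_m).div hr fun p hp => (h.r_pos p hp).ne')).sub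
    (contDiffOn_const.mul (hr.pow 2))).add h.smooth_Q

/-- The only terms of `A` that could depend on `x, y` are `K` and `(ln P)_u`. Regularity excludes
the second, so the transverse gradient of `A` is that of `K`. -/
theorem hasGrad_Af (hp : p ∈ Ω) : HasGrad S.Af
    (![pd 0 S.K p - 2 * p 1 * pd 0 (pd 0 S.lnP) p - 2 * pd 0 S.mf p / p 1 + pd 0 S.Qf p,
      -2 * pd 0 S.lnP p + 2 * S.mf p / p 1 ^ 2 - 2 * S.Lam / 3 * p 1 + pd 1 S.Qf p,
      pd 2 S.K p, pd 3 S.K p]) p := by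
  have hr := (h.r_pos p hp).ne'
  have hc := HasGrad.coord 1 p
  have h0 := hasGrad_of_contDiffOn h.isOpen (contDiffOn_pd h.isOpen h.smooth_lnP 0) hp
  have hK := hasGrad_of_contDiffOn h.isOpen h.smooth_K hp
  have hm := hasGrad_of_contDiffOn h.isOpen h.smooth_m hp
  have hQ := hasGrad_of_contDiffOn h.isOpen h.smooth_Q hp
  have hr1 : pd 1 (pd 0 S.lnP) p = 0 := by
    rw [pd_comm h.isOpen h.smooth_lnP hp]
    exact pd_eq_zero_of_eqOn_const h.isOpen (fun _ _ => pd_lnP_r) hp 0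
  have hA := (((hK.sub (((HasGrad.const 2 p).mul hc).mul h0)).sub
    (((HasGrad.const 2 p).mul hm).div hc hr)).sub
    ((HasGrad.const (S.Lam / 3) p).mul (hc.pow 2))).add hQ
  refine HasGrad.of_eq (f := S.Af) hA fun i => ?_
  fin_cases i
  · simp; field_simp
  · simp [hr1, pd_K_r, pd_mf]; field_simp; ring
  · simp [h.pd_xu p hp, pd_mf, pd_Qf]
  · simp [h.pd_yu p hp, pd_mf, pd_Qf]

theorem pd_pd_Af_xy (i : Fin 4) {j : Fin 4} (hj : j = 2 ∨ j = 3) (hp : p ∈ Ω) :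
    pd i (pd j S.Af) p = pd i (pd j S.K) p := by
  refine pd_congr h.isOpen (fun z hz => ?_) hp i
  rw [(h.hasGrad_Af hz).grad]
  rcases hj with rfl | rfl <;> simp

theorem pd_pd_Af_r (hp : p ∈ Ω) : pd 1 (pd 1 S.Af) p =
    -4 * S.mf p / p 1 ^ 3 - 2 * S.Lam / 3 + pd 1 (pd 1 S.Qf) p := by
  have hr := (h.r_pos p hp).ne'
  have hc := HasGrad.coord 1 p
  have h0 := hasGrad_of_contDiffOn h.isOpen (contDiffOn_pd h.isOpen h.smooth_lnP 0) hp
  have hm := hasGrad_of_contDiffOn h.isOpen h.smooth_m hp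
  have hQ := hasGrad_of_contDiffOn h.isOpen (contDiffOn_pd h.isOpen h.smooth_Q 1) hp
  have hr1 : pd 1 (pd 0 S.lnP) p = 0 := by
    rw [pd_comm h.isOpen h.smooth_lnP hp]
    exact pd_eq_zero_of_eqOn_const h.isOpen (fun _ _ => pd_lnP_r) hp 0
  have hA := ((((HasGrad.const (-2) p).mul h0).add
    (((HasGrad.const 2 p).mul hm).div (hc.pow 2) (by positivity))).sub
    ((HasGrad.const (2 * S.Lam / 3) p).mul hc)).add hQ
  have := (HasGrad.congr (f := pd 1 S.Af) h.isOpen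
    (fun z hz => (h.hasGrad_Af hz).grad 1) hp hA).grad 1
  rw [this]
  simp [hr1, pd_mf]
  field_simp
  ring

theorem isRTPair : IsRTPair S.Af S.Pf Ω where
  isOpen := h.isOpen
  r_ne p hp := (h.r_pos p hp).ne'
  P_ne p hp := (h.P_pos p hp).ne'
  smooth_A := h.smooth_Af
  smooth_P := h.smooth_P
  pd_r _ _ := pd_Pf_r
  pd_xu := h.pd_xu
  pd_yu := h.pd_yu
  pd_xr p hp := by
    rw [pd_comm h.isOpen h.smooth_Af hp, h.pd_pd_Af_xy 1 (.inl rfl) hp,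
      pd_comm h.isOpen h.smooth_K hp]
    exact pd_eq_zero_of_eqOn_const h.isOpen (fun _ _ => pd_K_r) hp 2
  pd_yr p hp := by
    rw [pd_comm h.isOpen h.smooth_Af hp, h.pd_pd_Af_xy 1 (.inr rfl) hp,
      pd_comm h.isOpen h.smooth_K hp]
    exact pd_eq_zero_of_eqOn_const h.isOpen (fun _ _ => pd_K_r) hp 3

/-- The function `2H` is designed so that `K`, `(ln P)_u` and `m` cancel from the diagonal, where
only `Q` and `-Λ` remain. The remaining functions meet in the single component `G^r_u`. -/
theorem einstein_eq (a b : Fin 4) (hp : p ∈ Ω) :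
    einstein S.metric a b p =
      (let α : ℝ := S.Qf p / p 1 ^ 2 + pd 1 S.Qf p / p 1 - S.Lam
       let β : ℝ := pd 1 S.Qf p / p 1 + pd 1 (pd 1 S.Qf) p / 2 - S.Lam
       !![α, 0, 0, 0;
          (2 * S.K p * pd 0 S.lnP p - pd 0 S.K p) / p 1
            - S.Pf p ^ 2 / p 1 ^ 2 * (pd 2 (pd 2 S.K) p + pd 3 (pd 3 S.K) p) / 2
            - (6 * S.mf p * pd 0 S.lnP p - 2 * pd 0 S.mf p) / p 1 ^ 2
            + (2 * S.Qf p / p 1 - pd 1 S.Qf p) * pd 0 S.lnP p - pd 0 S.Qf p / p 1, α, 0, 0;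
          0, 0, β, 0;
          0, 0, 0, β] a b) := by
  have hr := (h.r_pos p hp).ne'
  have hE := h.isRTPair.einstein_eq a b hp
  change einstein S.metric a b p = _ at hE
  rw [hE, show (fun z => Real.log (S.Pf z)) = S.lnP from rfl]
  have e0 : S.Af p = S.K p - 2 * p 1 * pd 0 S.lnP p - 2 * S.mf p / p 1 - S.Lam / 3 * p 1 ^ 2
    + S.Qf p := rfl
  have eK : S.Pf p ^ 2 / p 1 ^ 2 * (pd 2 (pd 2 S.lnP) p + pd 3 (pd 3 S.lnP) p)
    = S.K p / p 1 ^ 2 := by rw [K]; ring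
  simp only [eK, h.pd_pd_Af_xy 2 (.inl rfl) hp, h.pd_pd_Af_xy 3 (.inr rfl) hp, h.pd_pd_Af_r hp,
    (h.hasGrad_Af hp).grad, e0]
  fin_cases a <;> fin_cases b <;> simp <;> field_simp <;> ring

theorem Psi_eq (hp : p ∈ Ω) : S.Psi p =
    ![0, 0, (((1 / 12) * (pd 1 (pd 1 S.Qf) p - 2 / p 1 * pd 1 S.Qf p + 2 / p 1 ^ 2 * S.Qf p)
        - S.mf p / p 1 ^ 3 : ℝ) : ℂ),
      -((Real.sqrt 2 * S.Pf p / (4 * p 1 ^ 2) : ℝ) : ℂ) *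
        ((pd 2 S.K p : ℂ) - Complex.I * (pd 3 S.K p : ℂ)),
      ((1 / (4 * p 1 ^ 2) : ℝ) : ℂ) *
        (((pd 2 (fun z => S.Pf z ^ 2 * pd 2 S.K z) p : ℂ)
            - Complex.I * (pd 2 (fun z => S.Pf z ^ 2 * pd 3 S.K z) p : ℂ))
          - Complex.I * ((pd 3 (fun z => S.Pf z ^ 2 * pd 2 S.K z) p : ℂ)
            - Complex.I * (pd 3 (fun z => S.Pf z ^ 2 * pd 3 S.K z) p : ℂ)))] := by
  have hr := (h.r_pos p hp).ne'
  have hP := (h.P_pos p hp).ne'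
  have hW := h.isRTPair.weylScalars_eq hp
  have hl : S.lVec p = ![1, -((S.Af p / 2 : ℝ) : ℂ), 0, 0] := by
    rw [lVec, Af, add_div]
  have hPsi : S.Psi p = weylScalars (rtMetric S.Af S.Pf) p ![0, 1, 0, 0]
      ![1, -((S.Af p / 2 : ℝ) : ℂ), 0, 0]
      ![0, 0, ((S.Pf p / (Real.sqrt 2 * p 1) : ℝ) : ℂ),
        ((S.Pf p / (Real.sqrt 2 * p 1) : ℝ) : ℂ) * Complex.I] := by
    rw [Psi, hl]; rfl
  rw [hPsi, hW, show (fun z => Real.log (S.Pf z)) = S.lnP from rfl]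
  have e0 : S.Af p = S.K p - 2 * p 1 * pd 0 S.lnP p - 2 * S.mf p / p 1 - S.Lam / 3 * p 1 ^ 2
    + S.Qf p := rfl
  have eK : S.Pf p ^ 2 / p 1 ^ 2 * (pd 2 (pd 2 S.lnP) p + pd 3 (pd 3 S.lnP) p)
    = S.K p / p 1 ^ 2 := by rw [K]; ring
  have hd (i j : Fin 4) : pd i (fun z => S.Pf z ^ 2 * pd j S.K z) p
      = S.Pf p ^ 2 * (pd i (pd j S.K) p + 2 * pd i S.lnP p * pd j S.K p) := by
    rw [(((h.isRTPair.hasGrad_P hp).pow 2).mul (hasGrad_of_contDiffOn h.isOpen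
      (contDiffOn_pd h.isOpen h.smooth_K j) hp)).grad i]
    change _ * _ * (_ * pd i S.lnP p) * _ + _ = _
    simp
    ring
  simp only [eK, h.pd_pd_Af_xy _ (.inl rfl) hp, h.pd_pd_Af_xy _ (.inr rfl) hp, h.pd_pd_Af_r hp,
    (h.hasGrad_Af hp).grad, e0, hd, pd_comm h.isOpen h.smooth_K hp 3 2]
  ext n
  fin_cases n
  · simp
  · simp
  · simp only [Fin.reduceFinMk, Matrix.cons_val]
    congr 1
    field_simp
    ring
  · simp
  · simp
    linear_combination -(4 : ℂ)⁻¹ * ((p 1 : ℂ) ^ 2)⁻¹ * (S.Pf p : ℂ) ^ 2 *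
      (pd 3 (pd 3 S.K) p + 2 * pd 3 S.lnP p * pd 3 S.K p) * Complex.I_sq

theorem isNullTetrad (hp : p ∈ Ω) : IsNullTetrad S.metric p (kVec p) (S.lVec p) (S.mVec p) := by
  have hl : S.lVec p = ![1, -((S.Af p / 2 : ℝ) : ℂ), 0, 0] := by
    rw [lVec, Af, add_div]
  rw [hl]
  exact h.isRTPair.isNullTetrad hp

end IsRegular
end RTData

/-! ### Reduction of the field equations, and the change of mass -/

namespace RTData

variable {S : RTData} {Ω : Set Coord} {p : Coord}

theorem metric_eq_rtMetric : S.metric = rtMetric S.Af S.Pf := rfl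

theorem faradayUp_eq (hr : p 1 ≠ 0) (hP : S.Pf p ≠ 0) (a b : Fin 4) :
    S.faradayUp a b p = (!![0, -S.Ef p, 0, 0; S.Ef p, 0, 0, 0; 0, 0, 0, 0; 0, 0, 0, 0] :
      Matrix (Fin 4) (Fin 4) ℝ) a b := by
  simp only [faradayUp, metric_eq_rtMetric, rtMetric_inv hr hP, faraday, Fin.sum_univ_four]
  fin_cases a <;> fin_cases b <;> simp

theorem emInvariant_eq (hr : p 1 ≠ 0) (hP : S.Pf p ≠ 0) :
    S.emInvariant p = -2 * S.Ef p ^ 2 := by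
  simp only [emInvariant, faradayUp_eq hr hP, faraday, Fin.sum_univ_four]
  simp
  ring

theorem stress_eq (hr : p 1 ≠ 0) (hP : S.Pf p ≠ 0) (a b : Fin 4) :
    S.stress a b p =
      (let α : ℝ := 1 / 2 * S.L (-2 * S.Ef p ^ 2)
        + 2 * S.Ef p ^ 2 * deriv S.L (-2 * S.Ef p ^ 2)
       let β : ℝ := 1 / 2 * S.L (-2 * S.Ef p ^ 2)
       !![α, 0, 0, 0; 0, α, 0, 0; 0, 0, β, 0; 0, 0, 0, β] a b) := by
  simp only [stress, LF, emInvariant_eq hr hP, faradayUp_eq hr hP, faraday, Fin.sum_univ_four]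
  fin_cases a <;> fin_cases b <;> simp <;> ring

variable (S) in
/-- The function `r² L_F F_{ur}`. -/
def chargeFun (p : Coord) : ℝ := p 1 ^ 2 * (deriv S.L (-2 * S.Ef p ^ 2) * S.Ef p)

theorem pd_chargeFun {i : Fin 4} (hi : i ≠ 0) (hi' : i ≠ 1) : pd i S.chargeFun p = 0 :=
  pd_eq_zero_of_line fun t => by simp [chargeFun, Ef, hi.symm, hi'.symm]

theorem contDiffOn_chargeFun (hE : ContDiffOn ℝ ∞ S.Ef Ω)
    (hL : ∀ p ∈ Ω, ContDiffAt ℝ ∞ S.L (-2 * S.Ef p ^ 2)) : ContDiffOn ℝ ∞ S.chargeFun Ω := by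
  refine ((smooth_r Ω).pow 2).mul (ContDiffOn.mul ?_ hE)
  intro p hp
  -- `deriv` is `fderiv` applied to the constant vector `1`.
  have h1 : ContDiffAt ℝ ∞ (deriv S.L) (-2 * S.Ef p ^ 2) :=
    ((hL p hp).fderiv_right (m := ∞) (by simp)).clm_apply contDiffAt_const
  exact h1.comp_contDiffWithinAt p (contDiffWithinAt_const.mul ((hE p hp).pow 2))

/-- Since `√(-g) = r²/P²`, the density `√(-g) L_F F^{μν}` is `∓c / P²` in the `u, r` block with `c =
chargeFun`. The equations say that `c / P²` is constant in `r` and in `u`, and `P` does not depend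
on `r`. -/
theorem maxwell_iff (hΩ : IsOpen Ω) (hr : ∀ p ∈ Ω, 0 < p 1) (hP : ∀ p ∈ Ω, 0 < S.Pf p)
    (hPs : ContDiffOn ℝ ∞ S.Pf Ω) (hc : ContDiffOn ℝ ∞ S.chargeFun Ω) (hp : p ∈ Ω) :
    (∀ b, ∑ a, pd a (fun z => Real.sqrt (-(S.metric z).det) * S.LF z * S.faradayUp a b z) p = 0) ↔
      pd 1 S.chargeFun p = 0 ∧ pd 0 S.chargeFun p = 2 * S.chargeFun p * pd 0 S.lnP p := by
  have hP0 := (hP p hp).ne'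
  have key (a b : Fin 4) :
      pd a (fun z => Real.sqrt (-(S.metric z).det) * S.LF z * S.faradayUp a b z) p =
        (!![0, -1, 0, 0; 1, 0, 0, 0; 0, 0, 0, 0; 0, 0, 0, 0] : Matrix (Fin 4) (Fin 4) ℝ) a b *
          ((pd a S.chargeFun p * S.Pf p - S.chargeFun p * (2 * pd a S.Pf p)) / S.Pf p ^ 3) := by
    have e : ∀ z ∈ Ω, Real.sqrt (-(S.metric z).det) * S.LF z * S.faradayUp a b z =
        (!![0, -1, 0, 0; 1, 0, 0, 0; 0, 0, 0, 0; 0, 0, 0, 0] : Matrix (Fin 4) (Fin 4) ℝ) a b *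
          (S.chargeFun z / S.Pf z ^ 2) := by
      intro z hz
      have h1 := (hr z hz).ne'
      have h2 := (hP z hz).ne'
      rw [metric_eq_rtMetric, rtMetric_det, neg_neg, Real.sqrt_sq (by positivity), LF,
        emInvariant_eq h1 h2, faradayUp_eq h1 h2, chargeFun]
      fin_cases a <;> fin_cases b <;> simp <;> ring
    rw [pd_congr hΩ e hp, ((HasGrad.const _ p).mul ((hasGrad_of_contDiffOn hΩ hc hp).div
      ((hasGrad_of_contDiffOn hΩ hPs hp).pow 2) (by positivity))).grad a]
    simp only [zero_mul, zero_add]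
    congr 1
    field_simp
    simp
    ring
  have hPr : pd 1 S.Pf p = 0 := pd_Pf_r
  have hPu : pd 0 S.lnP p = pd 0 S.Pf p / S.Pf p :=
    ((hasGrad_of_contDiffOn hΩ hPs hp).log hP0).grad 0
  have h1 : (pd 1 S.chargeFun p * S.Pf p - S.chargeFun p * (2 * pd 1 S.Pf p)) / S.Pf p ^ 3 = 0 ↔
      pd 1 S.chargeFun p = 0 := by simp [hPr, hP0]
  have h2 : (pd 0 S.chargeFun p * S.Pf p - S.chargeFun p * (2 * pd 0 S.Pf p)) / S.Pf p ^ 3 = 0 ↔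
      pd 0 S.chargeFun p = 2 * S.chargeFun p * pd 0 S.lnP p := by
    rw [hPu, div_eq_zero_iff, or_iff_left (by positivity), sub_eq_zero, ← eq_div_iff hP0]
    ring_nf
  rw [← h1, ← h2]
  simp only [key, Fin.forall_fin_succ, Fin.sum_univ_four]
  simp

/-- The matter side of the field equations in reduced form. -/
structure IsReducedSolution (S : RTData) (Ω : Set Coord) : Prop where
  smooth_E : ContDiffOn ℝ ∞ S.Ef Ω
  smooth_L : ∀ p ∈ Ω, ContDiffAt ℝ ∞ S.L (-2 * S.Ef p ^ 2)
  E_ne : ∀ p ∈ Ω, S.Ef p ≠ 0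
  LF_ne : ∀ p ∈ Ω, deriv S.L (-2 * S.Ef p ^ 2) ≠ 0
  maxwell_r : ∀ p ∈ Ω, pd 1 S.chargeFun p = 0
  maxwell_u : ∀ p ∈ Ω, pd 0 S.chargeFun p = 2 * S.chargeFun p * pd 0 S.lnP p
  einstein_long : ∀ p ∈ Ω, S.Qf p / p 1 ^ 2 + pd 1 S.Qf p / p 1 =
    1 / 2 * S.L (-2 * S.Ef p ^ 2) + 2 * S.Ef p ^ 2 * deriv S.L (-2 * S.Ef p ^ 2)
  einstein_trans : ∀ p ∈ Ω, pd 1 S.Qf p / p 1 + pd 1 (pd 1 S.Qf) p / 2 =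
    1 / 2 * S.L (-2 * S.Ef p ^ 2)
  einstein_u : ∀ p ∈ Ω, (2 * S.K p * pd 0 S.lnP p - pd 0 S.K p) / p 1
      - S.Pf p ^ 2 / p 1 ^ 2 * (pd 2 (pd 2 S.K) p + pd 3 (pd 3 S.K) p) / 2
      - (6 * S.mf p * pd 0 S.lnP p - 2 * pd 0 S.mf p) / p 1 ^ 2
      + (2 * S.Qf p / p 1 - pd 1 S.Qf p) * pd 0 S.lnP p - pd 0 S.Qf p / p 1 = 0

/-- Maxwell's equation in `u` expresses `(ln P)_u` as `c_u / (2c)`, and the nowhere vanishing charge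
function `c` depends on `u, r` only. This has to come before any curvature computation, which relies
on it. -/
theorem IsSolution.isRegular (h : S.IsSolution Ω) : S.IsRegular Ω := by
  have hL : ∀ p ∈ Ω, ContDiffAt ℝ ∞ S.L (-2 * S.Ef p ^ 2) := fun p hp => by
    rw [← emInvariant_eq (h.r_pos p hp).ne' (h.P_pos p hp).ne']; exact h.smooth_L p hp
  have hc := contDiffOn_chargeFun h.smooth_E hL
  have hc0 : ∀ p ∈ Ω, S.chargeFun p ≠ 0 := fun p hp => by
    have := h.LF_ne p hp
    rw [LF, emInvariant_eq (h.r_pos p hp).ne' (h.P_pos p hp).ne'] at this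
    exact mul_ne_zero (pow_ne_zero 2 (h.r_pos p hp).ne') (mul_ne_zero this (h.E_ne p hp))
  have hu : ∀ z ∈ Ω, pd 0 S.lnP z = pd 0 S.chargeFun z / (2 * S.chargeFun z) := fun z hz => by
    rw [((maxwell_iff h.isOpen h.r_pos h.P_pos h.smooth_P hc hz).1 (h.maxwell z hz)).2]
    field_simp [hc0 z hz]
  have key (i : Fin 4) (hi : i ≠ 0) (hi' : i ≠ 1) (p : Coord) (hp : p ∈ Ω) :
      pd i (pd 0 S.lnP) p = 0 := by
    rw [pd_congr h.isOpen hu hp, ((hasGrad_of_contDiffOn h.isOpen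
      (contDiffOn_pd h.isOpen hc 0) hp).div ((HasGrad.const 2 p).mul
      (hasGrad_of_contDiffOn h.isOpen hc hp)) (mul_ne_zero two_ne_zero (hc0 p hp))).grad i,
      pd_comm h.isOpen hc hp, pd_chargeFun hi hi',
      pd_eq_zero_of_eqOn_const h.isOpen (fun _ _ => pd_chargeFun hi hi') hp]
    simp
  exact
    { isOpen := h.isOpen, r_pos := h.r_pos, P_pos := h.P_pos, smooth_P := h.smooth_P,
      smooth_m := h.smooth_m, smooth_Q := h.smooth_Q
      pd_xu := key 2 (by decide) (by decide)
      pd_yu := key 3 (by decide) (by decide) }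

theorem isSolution_iff : S.IsSolution Ω ↔ S.IsRegular Ω ∧ S.IsReducedSolution Ω := by
  constructor
  · intro h
    have hR := h.isRegular
    have hF : ∀ p ∈ Ω, S.emInvariant p = -2 * S.Ef p ^ 2 := fun p hp =>
      emInvariant_eq (h.r_pos p hp).ne' (h.P_pos p hp).ne'
    have hL : ∀ p ∈ Ω, ContDiffAt ℝ ∞ S.L (-2 * S.Ef p ^ 2) := fun p hp => by
      rw [← hF p hp]; exact h.smooth_L p hp
    have hm (p) (hp : p ∈ Ω) := (maxwell_iff h.isOpen h.r_pos h.P_pos h.smooth_P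
      (contDiffOn_chargeFun h.smooth_E hL) hp).1 (h.maxwell p hp)
    have he (p) (hp : p ∈ Ω) (a b : Fin 4) := h.einstein_eq p hp a b
    refine ⟨hR, h.smooth_E, hL, h.E_ne, fun p hp => ?_, fun p hp => (hm p hp).1,
      fun p hp => (hm p hp).2, fun p hp => ?_, fun p hp => ?_, fun p hp => ?_⟩
    · rw [← hF p hp]; exact h.LF_ne p hp
    all_goals
      have e (a b : Fin 4) := he p hp a b
      simp only [hR.einstein_eq _ _ hp, stress_eq (h.r_pos p hp).ne' (h.P_pos p hp).ne'] at e
    · simpa using e 0 0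
    · simpa using e 2 2
    · simpa using e 1 0
  · rintro ⟨h, k⟩
    have hF : ∀ p ∈ Ω, S.emInvariant p = -2 * S.Ef p ^ 2 := fun p hp =>
      emInvariant_eq (h.r_pos p hp).ne' (h.P_pos p hp).ne'
    refine ⟨h.isOpen, h.r_pos, h.P_pos, h.smooth_P, h.smooth_m, h.smooth_Q, k.smooth_E,
      fun p hp => ?_, k.E_ne, fun p hp => ?_, fun p hp => ?_, fun p hp a b => ?_⟩
    · rw [hF p hp]; exact k.smooth_L p hp
    · rw [LF, hF p hp]; exact k.LF_ne p hp
    · exact (maxwell_iff h.isOpen h.r_pos h.P_pos h.smooth_P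
        (contDiffOn_chargeFun k.smooth_E k.smooth_L) hp).2 ⟨k.maxwell_r p hp, k.maxwell_u p hp⟩
    · have e1 := k.einstein_long p hp
      have e2 := k.einstein_trans p hp
      have e3 := k.einstein_u p hp
      rw [h.einstein_eq a b hp, stress_eq (h.r_pos p hp).ne' (h.P_pos p hp).ne']
      simp only [e1, e2, e3]
      fin_cases a <;> fin_cases b <;> simp

/-- Only `einstein_u` contains `m`, through `m_u - 3m (ln P)_u`. This expression is linear in `m`
and vanishes for `q³`, because `q_u = q (ln P)_u`. -/
theorem IsSolution.withMass (h : S.IsSolution Ω) {q : ℝ → ℝ} (hq : S.IsCharge Ω q) (ε : ℝ) :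
    (S.withMass (fun u => S.m u + ε * q u ^ 3)).IsSolution Ω := by
  obtain ⟨hR, hS⟩ := isSolution_iff.1 h
  obtain ⟨hqs, hqc⟩ := hq
  refine isSolution_iff.2 ⟨{ hR with smooth_m := ?_ }, { hS with einstein_u := ?_ }⟩
  · exact hR.smooth_m.add (contDiffOn_const.mul (hqs.pow 3))
  · intro p hp
    have hc := contDiffOn_chargeFun hS.smooth_E hS.smooth_L
    have hc0 : S.chargeFun p ≠ 0 := mul_ne_zero (pow_ne_zero 2 (hR.r_pos p hp).ne')
      (mul_ne_zero (hS.LF_ne p hp) (hS.E_ne p hp))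
    -- Squaring `|c| = q²` removes the absolute value, so that the identity can be differentiated.
    have hcq : ∀ z ∈ Ω, S.chargeFun z ^ 2 = q (z 0) ^ 4 := fun z hz => by
      have h1 := (hR.r_pos z hz).ne'
      have := hqc z hz
      rw [LF, emInvariant_eq h1 (hR.P_pos z hz).ne', eq_div_iff (by positivity)] at this
      rw [← sq_abs, chargeFun, abs_mul, abs_of_nonneg (sq_nonneg _), mul_comm, this]
      ring
    have hgq := hasGrad_of_contDiffOn hR.isOpen hqs hp
    have hgm := hasGrad_of_contDiffOn hR.isOpen hR.smooth_m hp
    have hd := (HasGrad.congr hR.isOpen hcq hp (hgq.pow 4)).grad 0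
    rw [((hasGrad_of_contDiffOn hR.isOpen hc hp).pow 2).grad 0, hS.maxwell_u p hp] at hd
    have hq0 : q (p 0) ≠ 0 := fun h0 => by
      have := hcq p hp
      rw [h0] at this
      exact hc0 (by simpa using this)
    have hqu : pd 0 (fun z : Coord => q (z 0)) p = q (p 0) * pd 0 S.lnP p := by
      have h3 : q (p 0) ^ 3 ≠ 0 := pow_ne_zero 3 hq0
      -- Differentiating `c² = q⁴` and inserting `c_u = 2c (ln P)_u` gives `4 q⁴ (ln P)_u = 4 q³
      -- q_u`.
      refine mul_left_cancel₀ h3 ?_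
      norm_num at hd
      linear_combination -(1 / 4) * hd + pd 0 S.lnP p * hcq p hp
    have hmu : pd 0 (S.withMass (fun u => S.m u + ε * q u ^ 3)).mf p =
        pd 0 S.mf p + 3 * ε * q (p 0) ^ 3 * pd 0 S.lnP p := by
      have := (hgm.add ((HasGrad.const ε p).mul (hgq.pow 3))).grad 0
      refine Eq.trans this ?_
      rw [hqu]
      norm_num
      ring
    have e := hS.einstein_u p hp
    change (2 * S.K p * pd 0 S.lnP p - pd 0 S.K p) / p 1
      - S.Pf p ^ 2 / p 1 ^ 2 * (pd 2 (pd 2 S.K) p + pd 3 (pd 3 S.K) p) / 2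
      - (6 * (S.mf p + ε * q (p 0) ^ 3) * pd 0 S.lnP p - 2 * pd 0 (S.withMass _).mf p) / p 1 ^ 2
      + (2 * S.Qf p / p 1 - pd 1 S.Qf p) * pd 0 S.lnP p - pd 0 S.Qf p / p 1 = 0
    rw [hmu]
    linear_combination e

theorem IsCharge.ne_zero (h : S.IsSolution Ω) {q : ℝ → ℝ} (hq : S.IsCharge Ω q) (hp : p ∈ Ω) :
    q (p 0) ≠ 0 := fun h0 => by
  have := hq.2 p hp
  rw [h0] at this
  exact mul_ne_zero (h.LF_ne p hp) (h.E_ne p hp) (by simpa using this)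

end RTData

/-! ### Weyl spinors with a repeated principal null direction -/

/-- Peels off one index at a time, so that the sum over all 64 index tuples in the symmetrization
can be expanded. -/
theorem sum_fun_fin_succ {n : ℕ} {α M : Type*} [Fintype α] [AddCommMonoid M]
    (F : (Fin (n + 1) → α) → M) :
    ∑ f, F f = ∑ a, ∑ g : Fin n → α, F (Matrix.vecCons a g) := by
  rw [← (Fin.consEquiv fun _ : Fin (n + 1) => α).sum_comp, Fintype.sum_prod_type]
  rfl

/-- Raising an index with `ε` exchanges `0` and `1` up to sign: only `K' = 1 - K` contributes, with
sign `(-1)^K`. -/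
theorem sexticProduct_eq (ψ : Fin 5 → ℂ) (a : Fin 6 → Fin 2) :
    sexticProduct ψ a = ∑ K : Fin 2, ∑ L : Fin 2, ∑ M : Fin 2,
      (-1) ^ (K + L + M : ℕ) * spinor ψ (a 0) (a 1) (a 2) (1 - K) *
        spinor ψ (a 3) (a 4) (1 - L) (1 - M) * spinor ψ (a 5) K L M := by
  simp [sexticProduct, Fin.sum_univ_two, eps]
  ring

theorem covariantR_congr (ψ : Fin 5 → ℂ) {a b : Fin 6 → Fin 2}
    (h : ∑ i, (a i : ℕ) = ∑ i, (b i : ℕ)) : covariantR ψ a = covariantR ψ b := by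
  simp only [covariantR, symmetrize, h]

theorem covariantR_six {ψ : Fin 5 → ℂ} (h1 : ψ 1 = 0) : covariantR ψ ![1, 1, 1, 1, 1, 1] =
    ψ 3 * (2 * ψ 3 ^ 2 - 3 * ψ 2 * ψ 4) := by
  have hs : ∑ i, ((![1, 1, 1, 1, 1, 1] : Fin 6 → Fin 2) i : ℕ) = 6 := by decide
  have hc : Finset.card {b : Fin 6 → Fin 2 | (∑ i, (b i : ℕ)) = 6} = 1 := by decide
  rw [covariantR, symmetrize, hs, hc, Finset.sum_filter]
  simp only [sum_fun_fin_succ, Fintype.sum_unique, sexticProduct_eq, Fin.sum_univ_two,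
    Fin.sum_univ_six, spinor]
  simp [h1]
  ring

section

variable {ψ : Fin 5 → ℂ} (h0 : ψ 0 = 0) (h1 : ψ 1 = 0)
include h0 h1

theorem covariantR_low (a : Fin 6 → Fin 2) (ha : ∑ i, (a i : ℕ) ≤ 4) : covariantR ψ a = 0 := by
  rw [covariantR, symmetrize, div_eq_zero_iff]
  left
  generalize ∑ i, (a i : ℕ) = s at ha
  rw [Finset.sum_filter]
  simp only [sum_fun_fin_succ, Fintype.sum_unique, sexticProduct_eq, Fin.sum_univ_two,
    Fin.sum_univ_six, spinor]
  interval_cases s <;> simp [h0, h1]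
  ring

theorem covariantR_five : covariantR ψ ![0, 1, 1, 1, 1, 1] =
    1 / 2 * ψ 2 * (2 * ψ 3 ^ 2 - 3 * ψ 2 * ψ 4) := by
  have hs : ∑ i, ((![0, 1, 1, 1, 1, 1] : Fin 6 → Fin 2) i : ℕ) = 5 := by decide
  have hc : Finset.card {b : Fin 6 → Fin 2 | (∑ i, (b i : ℕ)) = 5} = 6 := by decide
  rw [covariantR, symmetrize, hs, hc, Finset.sum_filter]
  simp only [sum_fun_fin_succ, Fintype.sum_unique, sexticProduct_eq, Fin.sum_univ_two,
    Fin.sum_univ_six, spinor]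
  simp [h0, h1]
  ring

theorem invI_eq : invI ψ = 3 * ψ 2 ^ 2 := by simp [invI, h0, h1]

theorem invJ_eq : invJ ψ = -ψ 2 ^ 3 := by
  simp [invJ, h0, h1, Matrix.det_fin_three]
  ring

theorem quartic_eq (ξ : Fin 2 → ℂ) : quartic ψ ξ =
    6 * ψ 2 * ξ 0 ^ 2 * ξ 1 ^ 2 + 4 * ψ 3 * ξ 0 * ξ 1 ^ 3 + ψ 4 * ξ 1 ^ 4 := by
  simp only [quartic, spinor, Fin.sum_univ_two]
  simp [h0, h1]
  ring

/-- The quartic is `ξ₁²` times a quadratic form. Type II says that this form has two distinct roots,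
both different from the root of `ξ₁`: `Ψ₂ ≠ 0` excludes a common root, and the discriminant `8 (2Ψ₃²
- 3Ψ₂Ψ₄)` excludes a double one. -/
theorem isTypeII_iff_discr :
    IsTypeII ψ ↔ ψ 2 ≠ 0 ∧ 2 * ψ 3 ^ 2 - 3 * ψ 2 * ψ 4 ≠ 0 := by
  constructor
  · rintro ⟨α, β, γ, hαβ, hαγ, hβγ, h⟩
    have key (x y : ℂ) := h ![x, y]
    simp only [quartic_eq h0 h1, linForm, Matrix.cons_val_zero, Matrix.cons_val_one] at key
    simp only [NotProp] at hαβ hαγ hβγ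
    -- The five coefficients are compared by evaluating both sides at `(1,0)`, `(0,1)`, `(1,1)`,
    -- `(-1,1)` and `(2,1)`.
    have c0 : α 0 ^ 2 * β 0 * γ 0 = 0 := by linear_combination -key 1 0
    have c4 : ψ 4 = α 1 ^ 2 * β 1 * γ 1 := by linear_combination key 0 1
    have p1 := key 1 1
    have p2 := key (-1) 1
    have p3 := key 2 1
    have c1 : α 0 ^ 2 * (β 0 * γ 1 + β 1 * γ 0) + 2 * α 0 * α 1 * β 0 * γ 0 = 0 := by
      linear_combination (1 / 2) * p1 + (1 / 6) * p2 - (1 / 6) * p3 - 2 * c0 - (1 / 2) * c4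
    have c2 : 6 * ψ 2 = α 0 ^ 2 * β 1 * γ 1 + α 1 ^ 2 * β 0 * γ 0
        + 2 * α 0 * α 1 * (β 0 * γ 1 + β 1 * γ 0) := by
      linear_combination (1 / 2) * p1 + (1 / 2) * p2 + c0 - c4
    have c3 : 4 * ψ 3 = 2 * α 0 * α 1 * β 1 * γ 1 + α 1 ^ 2 * (β 0 * γ 1 + β 1 * γ 0) := by
      linear_combination (1 / 2) * p1 - (1 / 2) * p2 + c1
    -- The double factor must be `ξ₁`. Otherwise the vanishing of the `ξ₀⁴` and `ξ₀³ξ₁` coefficients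
    -- would make `ξ₁²` divide the product of `β` and `γ`, so that these would be proportional.
    have hα : α 0 = 0 := by
      by_contra hα
      have c0' : β 0 * γ 0 = 0 := by
        have := pow_ne_zero 2 hα
        rw [mul_assoc] at c0
        exact (mul_eq_zero.1 c0).resolve_left this
      have c1' : β 0 * γ 1 + β 1 * γ 0 = 0 := by
        have h2 := pow_ne_zero 2 hα
        refine (mul_eq_zero.1 (?_ : α 0 ^ 2 * _ = 0)).resolve_left h2
        linear_combination c1 - 2 * α 0 * α 1 * c0'
      apply hβγ
      rcases mul_eq_zero.1 c0' with hβ | hγ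
      · rw [hβ] at c1' ⊢
        linear_combination -c1'
      · rw [hγ] at c1' ⊢
        linear_combination c1'
    rw [hα] at c2 c3 hαβ hαγ
    have hα1 : α 1 ≠ 0 := fun h => hαβ (by rw [h]; ring)
    have hβ0 : β 0 ≠ 0 := fun h => hαβ (by rw [h]; ring)
    have hγ0 : γ 0 ≠ 0 := fun h => hαγ (by rw [h]; ring)
    have e2 : 6 * ψ 2 = α 1 ^ 2 * β 0 * γ 0 := by linear_combination c2
    have e3 : 4 * ψ 3 = α 1 ^ 2 * (β 0 * γ 1 + β 1 * γ 0) := by linear_combination c3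
    refine ⟨fun h => ?_, fun h => ?_⟩
    · rw [h, mul_zero] at e2
      exact mul_ne_zero (mul_ne_zero (pow_ne_zero 2 hα1) hβ0) hγ0 e2.symm
    -- The discriminant of `α₁²` times the product of `β` and `γ` is `α₁⁴ (β₀γ₁ - β₁γ₀)²`, which
    -- equals `8 (2Ψ₃² - 3Ψ₂Ψ₄)`.
    · refine mul_ne_zero (pow_ne_zero 4 hα1) (pow_ne_zero 2 hβγ) ?_
      linear_combination 8 * h - (4 * ψ 3 + α 1 ^ 2 * (β 0 * γ 1 + β 1 * γ 0)) * e3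
        + 24 * ψ 2 * c4 + 4 * α 1 ^ 2 * β 1 * γ 1 * e2
  · rintro ⟨h2, hD⟩
    -- Here `d² = 4Ψ₃² - 6Ψ₂Ψ₄`, a quarter of the discriminant. The quadratic formula then supplies
    -- the two simple factors below.
    obtain ⟨d, hd⟩ := IsAlgClosed.exists_pow_nat_eq
      (2 * (2 * ψ 3 ^ 2 - 3 * ψ 2 * ψ 4)) (n := 2) two_pos
    have hd0 : d ≠ 0 := fun h => hD (by rw [h] at hd; linear_combination -(1 / 2) * hd)
    refine ⟨![0, 1], ![6 * ψ 2, 2 * ψ 3 + d], ![1, (2 * ψ 3 - d) / (6 * ψ 2)], ?_, ?_, ?_, ?_⟩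
    · simp [NotProp, h2]
    · simp [NotProp]
    · simp only [NotProp, Matrix.cons_val_zero, Matrix.cons_val_one]
      rw [mul_div_cancel₀ _ (mul_ne_zero (by norm_num) h2)]
      intro h
      exact hd0 (by linear_combination -(1 / 2) * h)
    · intro ξ
      rw [quartic_eq h0 h1]
      simp only [linForm, Matrix.cons_val_zero, Matrix.cons_val_one]
      field_simp
      linear_combination ξ 1 ^ 4 * hd

/-- By symmetry a component depends only on its number of indices `1`. The two that can be nonzero
contain the factor `2Ψ₃² - 3Ψ₂Ψ₄`, and the cofactor of the one with five indices `1` is `Ψ₂ / 2`. -/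
theorem covariantR_ne_zero_iff (h2 : ψ 2 ≠ 0) :
    covariantR ψ ≠ 0 ↔ 2 * ψ 3 ^ 2 - 3 * ψ 2 * ψ 4 ≠ 0 := by
  refine not_congr ⟨fun h => ?_, fun h => ?_⟩
  · have := covariantR_five h0 h1
    rw [h] at this
    simpa [h2] using this.symm
  · funext a
    have hle : ∑ i, (a i : ℕ) ≤ 6 := by
      calc ∑ i, (a i : ℕ) ≤ ∑ _i : Fin 6, 1 := Finset.sum_le_sum fun i _ => by omega
        _ = 6 := by simp
    rcases (by omega : ∑ i, (a i : ℕ) ≤ 4 ∨ ∑ i, (a i : ℕ) = 5 ∨ ∑ i, (a i : ℕ) = 6) with hs | hs | hs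
    · exact covariantR_low h0 h1 a hs
    · rw [covariantR_congr ψ (b := ![0, 1, 1, 1, 1, 1]) (hs.trans (by decide)),
        covariantR_five h0 h1, h]
      simp
    · rw [covariantR_congr ψ (b := ![1, 1, 1, 1, 1, 1]) (hs.trans (by decide)),
        covariantR_six h1, h]
      simp

theorem isTypeII_iff : IsTypeII ψ ↔ invI ψ * invJ ψ ≠ 0 ∧ covariantR ψ ≠ 0 := by
  have hIJ : invI ψ * invJ ψ ≠ 0 ↔ ψ 2 ≠ 0 := by simp [invI_eq h0 h1, invJ_eq h0 h1]
  rw [isTypeII_iff_discr h0 h1, hIJ]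
  exact and_congr_right fun h => (covariantR_ne_zero_iff h0 h1 h).symm

theorem isTypeD_of (h2 : ψ 2 ≠ 0) (h3 : ψ 3 = 0) (h4 : ψ 4 = 0) : IsTypeD ψ := by
  obtain ⟨d, hd⟩ := IsAlgClosed.exists_pow_nat_eq (6 * ψ 2) (n := 2) two_pos
  have hd0 : d ≠ 0 := fun h => h2 (by rw [h] at hd; linear_combination -(1 / 6) * hd)
  refine ⟨![d, 0], ![0, 1], by simp [NotProp, hd0], fun ξ => ?_⟩
  rw [quartic_eq h0 h1, h3, h4]
  simp only [linForm, Matrix.cons_val_zero, Matrix.cons_val_one]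
  linear_combination -ξ 0 ^ 2 * ξ 1 ^ 2 * hd

theorem isTypeN_imp (h : IsTypeN ψ) : ψ 2 = 0 ∧ ψ 3 = 0 ∧ ψ 4 ≠ 0 := by
  obtain ⟨α, hα, h⟩ := h
  have key (x y : ℂ) := h ![x, y]
  simp only [quartic_eq h0 h1, linForm, Matrix.cons_val_zero, Matrix.cons_val_one] at key
  -- The form vanishes at `(1,0)`, so the fourth power is a multiple of `ξ₁⁴`, and the `ξ₀²ξ₁²` and
  -- `ξ₀ξ₁³` terms must be absent.
  have hα0 : α 0 = 0 := pow_eq_zero_iff (n := 4) (by norm_num) |>.1 (by linear_combination -key 1 0)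
  have hα1 : α 1 ≠ 0 := fun h1 => hα (by ext i; fin_cases i <;> simp [hα0, h1])
  have k4 := key 0 1
  have k1 := key 1 1
  have k2 := key (-1) 1
  rw [hα0] at k1 k2 k4
  refine ⟨by linear_combination (1 / 12) * k1 + (1 / 12) * k2 - (1 / 6) * k4,
    by linear_combination (1 / 8) * k1 - (1 / 8) * k2, fun h => ?_⟩
  rw [h] at k4
  exact pow_ne_zero 4 hα1 (by linear_combination -k4)

end

theorem encard_not_isTypeII_le {ψ : ℝ → Fin 5 → ℂ} (h0 : ∀ t, ψ t 0 = 0) (h1 : ∀ t, ψ t 1 = 0)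
    {a b : ℝ} (hb : b ≠ 0) (h2 : ∀ t, ψ t 2 = ((a + t * b : ℝ) : ℂ)) {s w : ℂ} (hs : s ≠ 0)
    (h3 : ∀ t, ψ t 3 = s) (h4 : ∀ t, ψ t 4 = w) : {t | ¬ IsTypeII (ψ t)}.encard ≤ 2 := by
  have hsub : {t | ¬ IsTypeII (ψ t)} ⊆
      {-a / b} ∪ {t : ℝ | 2 * s ^ 2 - 3 * ((a + t * b : ℝ) : ℂ) * w = 0} := by
    intro t ht
    rw [Set.mem_ofPred_eq, isTypeII_iff_discr (h0 t) (h1 t), h2, h3, h4, not_and_or, not_not,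
      not_not] at ht
    refine ht.imp (fun h => ?_) id
    have h' : a + t * b = 0 := by exact_mod_cast h
    rw [Set.mem_singleton_iff, eq_div_iff hb]
    linarith
  -- The expression is affine in `t` with slope `-3bw`. If `w = 0` it is the nonzero constant `2s²`
  -- and has no zero at all.
  have hone : {t : ℝ | 2 * s ^ 2 - 3 * ((a + t * b : ℝ) : ℂ) * w = 0}.encard ≤ 1 := by
    rw [Set.encard_le_one_iff]
    intro t t' ht ht'
    rw [Set.mem_ofPred_eq] at ht ht'
    push_cast at ht ht'
    have hw : w ≠ 0 := fun h => hs (by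
      rw [h] at ht
      exact pow_eq_zero_iff (n := 2) two_ne_zero |>.1 (by linear_combination (1 / 2) * ht))
    have h' : ((t : ℂ) - t') * (b * w) = 0 := by linear_combination (1 / 3) * (ht' - ht)
    have hbw : (b : ℂ) * w ≠ 0 := mul_ne_zero (by exact_mod_cast hb) hw
    exact_mod_cast sub_eq_zero.1 ((mul_eq_zero.1 h').resolve_right hbw)
  calc {t | ¬ IsTypeII (ψ t)}.encard ≤ _ := Set.encard_le_encard hsub
    _ ≤ _ := Set.encard_union_le _ _
    _ ≤ 1 + 1 := add_le_add (Set.encard_singleton _).le hone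
    _ = 2 := one_add_one_eq_two

theorem encard_not_isTypeD_le {ψ : ℝ → Fin 5 → ℂ} (h0 : ∀ t, ψ t 0 = 0) (h1 : ∀ t, ψ t 1 = 0)
    {a b : ℝ} (hb : b ≠ 0) (h2 : ∀ t, ψ t 2 = ((a + t * b : ℝ) : ℂ))
    (h3 : ∀ t, ψ t 3 = 0) (h4 : ∀ t, ψ t 4 = 0) : {t | ¬ IsTypeD (ψ t)}.encard ≤ 1 := by
  refine (Set.encard_le_encard (t := {-a / b}) fun t ht => ?_).trans (Set.encard_singleton _).le
  by_contra hne
  refine ht (isTypeD_of (h0 t) (h1 t) (fun h => hne ?_) (h3 t) (h4 t))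
  rw [h2] at h
  have h' : a + t * b = 0 := by exact_mod_cast h
  rw [Set.mem_singleton_iff, eq_div_iff hb]
  linarith

/-! ### Petrov types of regular data -/

namespace RTData

variable {S : RTData} {Ω : Set Coord} {p : Coord}

namespace IsRegular

variable (h : S.IsRegular Ω)
include h

theorem Psi_zero (hp : p ∈ Ω) : S.Psi p 0 = 0 := by rw [h.Psi_eq hp]; rfl

theorem Psi_one (hp : p ∈ Ω) : S.Psi p 1 = 0 := by rw [h.Psi_eq hp]; rfl

theorem Psi_two (hp : p ∈ Ω) : S.Psi p 2 =
    (((1 / 12) * (pd 1 (pd 1 S.Qf) p - 2 / p 1 * pd 1 S.Qf p + 2 / p 1 ^ 2 * S.Qf p)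
      - S.mf p / p 1 ^ 3 : ℝ) : ℂ) := by rw [h.Psi_eq hp]; rfl

theorem Psi_three (hp : p ∈ Ω) : S.Psi p 3 =
    -((Real.sqrt 2 * S.Pf p / (4 * p 1 ^ 2) : ℝ) : ℂ) *
      ((pd 2 S.K p : ℂ) - Complex.I * (pd 3 S.K p : ℂ)) := by rw [h.Psi_eq hp]; rfl

theorem Psi_four (hp : p ∈ Ω) : S.Psi p 4 = ((1 / (4 * p 1 ^ 2) : ℝ) : ℂ) *
    (((pd 2 (fun z => S.Pf z ^ 2 * pd 2 S.K z) p : ℂ)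
        - Complex.I * (pd 2 (fun z => S.Pf z ^ 2 * pd 3 S.K z) p : ℂ))
      - Complex.I * ((pd 3 (fun z => S.Pf z ^ 2 * pd 2 S.K z) p : ℂ)
        - Complex.I * (pd 3 (fun z => S.Pf z ^ 2 * pd 3 S.K z) p : ℂ))) := by
  rw [h.Psi_eq hp]; rfl

theorem Psi_three_eq_zero_iff (hp : p ∈ Ω) :
    S.Psi p 3 = 0 ↔ pd 2 S.K p = 0 ∧ pd 3 S.K p = 0 := by
  have hr := h.r_pos p hp
  have hP := h.P_pos p hp
  have hc : -((Real.sqrt 2 * S.Pf p / (4 * p 1 ^ 2) : ℝ) : ℂ) ≠ 0 := by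
    rw [neg_ne_zero, Complex.ofReal_ne_zero]
    positivity
  rw [h.Psi_three hp, mul_eq_zero, or_iff_right hc, Complex.ext_iff]
  simp

/-- `Ψ₄` differentiates the gradient of `K` once more, so that gradient has to vanish on a
neighbourhood. The set `U` is kept separate from `Ω` so that it can be the interior of the type N
locus. -/
theorem Psi_four_eq_zero_of {U : Set Coord} (hU : IsOpen U)
    (hK : ∀ z ∈ U, pd 2 S.K z = 0 ∧ pd 3 S.K z = 0) (hpU : p ∈ U) (hp : p ∈ Ω) :
    S.Psi p 4 = 0 := by
  have h2 : ∀ z ∈ U, S.Pf z ^ 2 * pd 2 S.K z = 0 := fun z hz => by rw [(hK z hz).1, mul_zero]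
  have h3 : ∀ z ∈ U, S.Pf z ^ 2 * pd 3 S.K z = 0 := fun z hz => by rw [(hK z hz).2, mul_zero]
  rw [h.Psi_four hp]
  simp only [pd_eq_zero_of_eqOn_const hU h2 hpU, pd_eq_zero_of_eqOn_const hU h3 hpU]
  simp

theorem interior_isTypeN : interior {p | p ∈ Ω ∧ IsTypeN (S.Psi p)} = ∅ := by
  refine Set.eq_empty_of_forall_notMem fun p hp => ?_
  have hU (z) (hz : z ∈ interior {p | p ∈ Ω ∧ IsTypeN (S.Psi p)}) := interior_subset hz
  have hN (z) (hz : z ∈ interior {p | p ∈ Ω ∧ IsTypeN (S.Psi p)}) :=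
    isTypeN_imp (h.Psi_zero (hU z hz).1) (h.Psi_one (hU z hz).1) (hU z hz).2
  exact (hN p hp).2.2 (h.Psi_four_eq_zero_of isOpen_interior
    (fun z hz => (h.Psi_three_eq_zero_iff (hU z hz).1).1 (hN z hz).2.1) hp (hU p hp).1)

theorem pd_K_eq_zero {κ : ℝ → ℝ} (hκ : ∀ p ∈ Ω, S.K p = κ (p 0)) (hp : p ∈ Ω) :
    pd 2 S.K p = 0 ∧ pd 3 S.K p = 0 := by
  constructor <;> rw [pd_congr h.isOpen hκ hp] <;> exact pd_eq_zero_of_line fun t => by simp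

end IsRegular

/-! ### Solutions of type II from static solutions -/

/-- The function `P = x^{3/2}`, for which `K = -3x/2` is harmonic. -/
def cubicP (x _y : ℝ) : ℝ := x * Real.sqrt x

section

variable {Lam : ℝ} {L : ℝ → ℝ} {m : ℝ} {f E : ℝ → ℝ}

theorem smooth_cubicP (hx : ∀ p ∈ Ω, 0 < p 2) :
    ContDiffOn ℝ ∞ (static Lam L cubicP m f E).Pf Ω := by
  have h2 : ContDiffOn ℝ ∞ (fun p : Coord => p 2) Ω := (contDiff_apply ℝ ℝ (2 : Fin 4)).contDiffOn
  exact h2.mul (h2.sqrt fun p hp => (hx p hp).ne')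

theorem pd_lnP_static {P : ℝ → ℝ → ℝ} : pd 0 (static Lam L P m f E).lnP = 0 :=
  funext fun _ => pd_eq_zero_of_line fun t => by simp [lnP, Pf, static]

theorem K_cubicP (hΩ : IsOpen Ω) (hx : ∀ p ∈ Ω, 0 < p 2) (hp : p ∈ Ω) :
    (static Lam L cubicP m f E).K p = -(3 / 2) * p 2 := by
  have hl (z) (hz : z ∈ Ω) : (static Lam L cubicP m f E).lnP z = 3 / 2 * Real.log (z 2) := by
    have h := hx z hz
    change Real.log (z 2 * Real.sqrt (z 2)) = _
    rw [Real.log_mul h.ne' (Real.sqrt_pos.2 h).ne', Real.log_sqrt h.le]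
    ring
  have hg (z) (hz : z ∈ Ω) := HasGrad.congr hΩ hl hz ((HasGrad.const (3 / 2) z).mul
    ((HasGrad.coord 2 z).log (hx z hz).ne'))
  have h2 (z) (hz : z ∈ Ω) : pd 2 (static Lam L cubicP m f E).lnP z = 3 / 2 * (z 2)⁻¹ := by
    rw [(hg z hz).grad 2]; simp
  have h3 (z) (hz : z ∈ Ω) : pd 3 (static Lam L cubicP m f E).lnP z = 0 := by
    rw [(hg z hz).grad 3]; simp
  have h0 := hx p hp
  rw [K, pd_congr hΩ h2 hp, pd_eq_zero_of_eqOn_const hΩ h3 hp,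
    ((HasGrad.const (3 / 2) p).mul ((HasGrad.coord 2 p).inv h0.ne')).grad 2]
  change (p 2 * Real.sqrt (p 2)) ^ 2 * _ = _
  rw [mul_pow, Real.sq_sqrt h0.le]
  simp
  field_simp

theorem pd_K_cubicP (hΩ : IsOpen Ω) (hx : ∀ p ∈ Ω, 0 < p 2) (hp : p ∈ Ω) (i : Fin 4) :
    pd i (static Lam L cubicP m f E).K p = if i = 2 then -(3 / 2) else 0 := by
  rw [pd_congr hΩ (fun z hz => K_cubicP hΩ hx hz) hp,
    ((HasGrad.const (-(3 / 2)) p).mul (HasGrad.coord 2 p)).grad i]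
  simp

/-- With nothing depending on `u`, `einstein_u` becomes `K_xx + K_yy = 0`, which the linear function
`K = -3x/2` satisfies. What remains are conditions on `f`, `E` and `L`. -/
theorem isSolution_cubicP (hΩ : IsOpen Ω) (hr : ∀ p ∈ Ω, 0 < p 1) (hx : ∀ p ∈ Ω, 0 < p 2)
    (hQ : ContDiffOn ℝ ∞ (fun p : Coord => f (p 1)) Ω)
    (hE : ContDiffOn ℝ ∞ (fun p : Coord => E (p 1)) Ω)
    (hL : ∀ p ∈ Ω, ContDiffAt ℝ ∞ L (-2 * E (p 1) ^ 2))
    (hE0 : ∀ p ∈ Ω, E (p 1) ≠ 0) (hL0 : ∀ p ∈ Ω, deriv L (-2 * E (p 1) ^ 2) ≠ 0)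
    (hmax : ∀ p ∈ Ω, pd 1 (fun z => z 1 ^ 2 * (deriv L (-2 * E (z 1) ^ 2) * E (z 1))) p = 0)
    (hlong : ∀ p ∈ Ω, f (p 1) / p 1 ^ 2 + pd 1 (fun z => f (z 1)) p / p 1 =
      1 / 2 * L (-2 * E (p 1) ^ 2) + 2 * E (p 1) ^ 2 * deriv L (-2 * E (p 1) ^ 2))
    (htrans : ∀ p ∈ Ω, pd 1 (fun z => f (z 1)) p / p 1 + pd 1 (pd 1 (fun z => f (z 1))) p / 2 =
      1 / 2 * L (-2 * E (p 1) ^ 2)) :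
    (static Lam L cubicP m f E).IsSolution Ω := by
  refine isSolution_iff.2 ⟨⟨hΩ, hr, fun p hp => mul_pos (hx p hp) (Real.sqrt_pos.2 (hx p hp)),
    smooth_cubicP hx, contDiffOn_const, hQ, fun p _ => ?_, fun p _ => ?_⟩,
    hE, hL, hE0, hL0, hmax, fun p hp => ?_, hlong, htrans, fun p hp => ?_⟩
  · rw [pd_lnP_static]; exact (HasGrad.const 0 p).grad 2
  · rw [pd_lnP_static]; exact (HasGrad.const 0 p).grad 3
  · rw [pd_lnP_static, Pi.zero_apply, mul_zero]
    exact pd_eq_zero_of_line fun t => by simp [chargeFun, Ef, static]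
  · have hm : pd 0 (static Lam L cubicP m f E).mf p = 0 := (HasGrad.const m p).grad 0
    have hQ0 : pd 0 (static Lam L cubicP m f E).Qf p = 0 :=
      pd_eq_zero_of_line fun t => by simp [Qf, static]
    have h2 : pd 2 (pd 2 (static Lam L cubicP m f E).K) p = 0 :=
      pd_eq_zero_of_eqOn_const hΩ (fun z hz => pd_K_cubicP hΩ hx hz 2) hp 2
    have h3 : pd 3 (pd 3 (static Lam L cubicP m f E).K) p = 0 :=
      pd_eq_zero_of_eqOn_const hΩ (fun z hz => pd_K_cubicP hΩ hx hz 3) hp 3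
    rw [pd_lnP_static, hm, hQ0, h2, h3, pd_K_cubicP hΩ hx hp]
    simp

/-- The conditions on `f`, `E` and `L` mention neither `P` nor the mass, so they carry over from the
spherical solution with any new `m`. -/
theorem static_isSolution_cubicP {J : Set ℝ} {m₀ : ℝ}
    (h : (static Lam L sphereP m₀ f E).IsSolution {p | p 1 ∈ J}) :
    (static Lam L cubicP m f E).IsSolution
      {p | p 1 ∈ J ∧ (p 2, p 3) ∈ {v : ℝ × ℝ | 0 < v.1}} := by
  obtain ⟨hR, hS⟩ := isSolution_iff.1 h
  have hs : {p : Coord | p 1 ∈ J ∧ (p 2, p 3) ∈ {v : ℝ × ℝ | 0 < v.1}} ⊆ {p | p 1 ∈ J} :=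
    fun p hp => hp.1
  exact isSolution_cubicP
    (hR.isOpen.inter (isOpen_lt continuous_const (continuous_apply (2 : Fin 4))))
    (fun p hp => hR.r_pos p (hs hp)) (fun p hp => hp.2) (hR.smooth_Q.mono hs)
    (hS.smooth_E.mono hs) (fun p hp => hS.smooth_L p (hs hp)) (fun p hp => hS.E_ne p (hs hp))
    (fun p hp => hS.LF_ne p (hs hp)) (fun p hp => hS.maxwell_r p (hs hp))
    (fun p hp => hS.einstein_long p (hs hp)) (fun p hp => hS.einstein_trans p (hs hp))

end

theorem maxwell_isSolution_cubicP (Lam : ℝ) :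
    (static Lam (fun F => -F) cubicP 0 (fun r => (r ^ 2)⁻¹) (fun r => (r ^ 2)⁻¹)).IsSolution
      {p | 0 < p 1 ∧ 0 < p 2} ∧
    ∀ p : Coord, 0 < p 1 → 0 < p 2 → IsTypeII ((static Lam (fun F => -F) cubicP 0
      (fun r => (r ^ 2)⁻¹) (fun r => (r ^ 2)⁻¹)).Psi p) := by
  set Ω : Set Coord := {p | 0 < p 1 ∧ 0 < p 2} with hΩdef
  have hΩ : IsOpen Ω := (isOpen_lt continuous_const (continuous_apply (1 : Fin 4))).inter
    (isOpen_lt continuous_const (continuous_apply (2 : Fin 4)))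
  have hr : ∀ p ∈ Ω, 0 < p 1 := fun p hp => hp.1
  have hx : ∀ p ∈ Ω, 0 < p 2 := fun p hp => hp.2
  have hsm : ContDiffOn ℝ ∞ (fun p : Coord => (p 1 ^ 2)⁻¹) Ω :=
    ((smooth_r Ω).pow 2).inv fun p hp => pow_ne_zero 2 (hr p hp).ne'
  have hL (x : ℝ) : deriv (fun F : ℝ => -F) x = -1 := by simp
  have hd1 : ∀ p ∈ Ω, pd 1 (fun z : Coord => (z 1 ^ 2)⁻¹) p = -2 * (p 1 ^ 3)⁻¹ := fun p hp => by
    have h0 := (hr p hp).ne'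
    rw [(((HasGrad.coord 1 p).pow 2).inv (pow_ne_zero 2 h0)).grad 1]
    simp
    field_simp
  have hd2 : ∀ p ∈ Ω, pd 1 (pd 1 (fun z : Coord => (z 1 ^ 2)⁻¹)) p = 6 * (p 1 ^ 4)⁻¹ :=
    fun p hp => by
      have h0 := (hr p hp).ne'
      rw [pd_congr hΩ hd1 hp, ((HasGrad.const (-2) p).mul
        (((HasGrad.coord 1 p).pow 3).inv (pow_ne_zero 3 h0))).grad 1]
      simp
      field_simp
      norm_num
  have hsol : (static Lam (fun F => -F) cubicP 0 (fun r => (r ^ 2)⁻¹)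
      (fun r => (r ^ 2)⁻¹)).IsSolution Ω := by
    refine isSolution_cubicP hΩ hr hx hsm hsm (fun p _ => contDiffAt_id.neg)
      -- Here `L_F = -1` and `E = 1/r²`, so `r² L_F E` is the constant `-1`.
      (fun p hp => inv_ne_zero (pow_ne_zero 2 (hr p hp).ne')) (fun p _ => by simp [hL])
      (fun p hp => ?_) (fun p hp => ?_) (fun p hp => ?_)
    · refine pd_eq_zero_of_eqOn_const hΩ (c := -1) (fun z hz => ?_) hp 1
      have h0 := (hr z hz).ne'
      rw [hL]
      field_simp
    · have h0 := (hr p hp).ne'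
      rw [hd1 p hp, hL]
      field_simp
    · have h0 := (hr p hp).ne'
      rw [hd1 p hp, hd2 p hp]
      field_simp
      ring
  refine ⟨hsol, fun p hp1 hp2 => ?_⟩
  have hp : p ∈ Ω := ⟨hp1, hp2⟩
  have hR := hsol.isRegular
  set S := static Lam (fun F => -F) cubicP 0 (fun r => (r ^ 2)⁻¹) (fun r => (r ^ 2)⁻¹) with hS
  have hP (z : Coord) (hz : z ∈ Ω) : S.Pf z ^ 2 = z 2 ^ 3 := by
    change (z 2 * Real.sqrt (z 2)) ^ 2 = _
    rw [mul_pow, Real.sq_sqrt (hx z hz).le]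
    ring
  have e2 : S.Psi p 2 = (((p 1 ^ 4)⁻¹ : ℝ) : ℂ) := by
    rw [hR.Psi_two hp]
    change ((1 / 12 * (pd 1 (pd 1 (fun z : Coord => (z 1 ^ 2)⁻¹)) p
      - 2 / p 1 * pd 1 (fun z : Coord => (z 1 ^ 2)⁻¹) p + 2 / p 1 ^ 2 * (p 1 ^ 2)⁻¹)
      - 0 / p 1 ^ 3 : ℝ) : ℂ) = _
    rw [hd1 p hp, hd2 p hp]
    congr 1
    field_simp
    norm_num
  have e3 : S.Psi p 3 ^ 2 = ((9 * p 2 ^ 3 / (32 * p 1 ^ 4) : ℝ) : ℂ) := by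
    rw [hR.Psi_three hp, pd_K_cubicP hΩ hx hp, pd_K_cubicP hΩ hx hp, mul_pow, neg_sq,
      ← Complex.ofReal_pow, div_pow, mul_pow, hP p hp, Real.sq_sqrt (by norm_num)]
    simp
    ring
  have e4 : S.Psi p 4 = ((-(9 * p 2 ^ 2 / (8 * p 1 ^ 2)) : ℝ) : ℂ) := by
    have k2 : ∀ z ∈ Ω, S.Pf z ^ 2 * pd 2 S.K z = -(3 / 2) * z 2 ^ 3 := fun z hz => by
      rw [pd_K_cubicP hΩ hx hz, hP z hz]; simp; ring
    have k3 : ∀ z ∈ Ω, S.Pf z ^ 2 * pd 3 S.K z = 0 := fun z hz => by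
      rw [pd_K_cubicP hΩ hx hz]; simp
    rw [hR.Psi_four hp]
    simp only [pd_eq_zero_of_eqOn_const hΩ k3 hp, pd_congr hΩ k2 hp,
      ((HasGrad.const (-(3 / 2)) p).mul ((HasGrad.coord 2 p).pow 3)).grad]
    simp
    ring
  rw [isTypeII_iff_discr (hR.Psi_zero hp) (hR.Psi_one hp), e2, e3, e4]
  have hr1 := hr p hp
  have hx1 := hx p hp
  refine ⟨by rw [Complex.ofReal_ne_zero]; positivity, ?_⟩
  -- No exceptional points occur: `Ψ₃² > 0` and `Ψ₂ > 0 > Ψ₄`, so both terms of `2Ψ₃² - 3Ψ₂Ψ₄` are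
  -- positive.
  have hpos : 2 * (9 * p 2 ^ 3 / (32 * p 1 ^ 4)) - 3 * (p 1 ^ 4)⁻¹ * -(9 * p 2 ^ 2 / (8 * p 1 ^ 2))
      ≠ 0 := by
    rw [mul_neg, sub_neg_eq_add]
    positivity
  exact_mod_cast hpos

end RTData

end RobinsonTrautman

end

/-! ### The main theorem -/

theorem mainTheorem3 :
    (∀ (Ω : Set RobinsonTrautman.Coord) (S : RobinsonTrautman.RTData), S.IsSolution Ω →
      -- the tetrad is null, the Weyl scalars, the invariants and the sextic covariant
      (∀ p ∈ Ω,
        RobinsonTrautman.IsNullTetrad S.metric p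
          (RobinsonTrautman.RTData.kVec p) (S.lVec p) (S.mVec p) ∧
        S.Psi p 0 = 0 ∧
        S.Psi p 1 = 0 ∧
        S.Psi p 2 = (((1 / 12) * (RobinsonTrautman.pd 1 (RobinsonTrautman.pd 1 S.Qf) p
            - 2 / p 1 * RobinsonTrautman.pd 1 S.Qf p + 2 / p 1 ^ 2 * S.Qf p)
            - S.mf p / p 1 ^ 3 : ℝ) : ℂ) ∧
        S.Psi p 3 = -((Real.sqrt 2 * S.Pf p / (4 * p 1 ^ 2) : ℝ) : ℂ) *
            ((RobinsonTrautman.pd 2 S.K p : ℂ) - Complex.I * (RobinsonTrautman.pd 3 S.K p : ℂ)) ∧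
        S.Psi p 4 = ((1 / (4 * p 1 ^ 2) : ℝ) : ℂ) *
            (((RobinsonTrautman.pd 2
                  (fun z => S.Pf z ^ 2 * RobinsonTrautman.pd 2 S.K z) p : ℂ)
                - Complex.I * (RobinsonTrautman.pd 2
                  (fun z => S.Pf z ^ 2 * RobinsonTrautman.pd 3 S.K z) p : ℂ))
              - Complex.I * ((RobinsonTrautman.pd 3
                  (fun z => S.Pf z ^ 2 * RobinsonTrautman.pd 2 S.K z) p : ℂ)
                - Complex.I * (RobinsonTrautman.pd 3
                  (fun z => S.Pf z ^ 2 * RobinsonTrautman.pd 3 S.K z) p : ℂ))) ∧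
        RobinsonTrautman.invI (S.Psi p) ^ 3 = 27 * RobinsonTrautman.invJ (S.Psi p) ^ 2 ∧
        RobinsonTrautman.covariantR (S.Psi p) ![0, 1, 1, 1, 1, 1] =
          (1 / 2) * S.Psi p 2 * (2 * S.Psi p 3 ^ 2 - 3 * S.Psi p 2 * S.Psi p 4) ∧
        RobinsonTrautman.covariantR (S.Psi p) ![1, 1, 1, 1, 1, 1] =
          S.Psi p 3 * (2 * S.Psi p 3 ^ 2 - 3 * S.Psi p 2 * S.Psi p 4) ∧
        (∀ a : Fin 6 → Fin 2, (∑ i, (a i : ℕ)) ≤ 4 →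
          RobinsonTrautman.covariantR (S.Psi p) a = 0) ∧
        (RobinsonTrautman.IsTypeII (S.Psi p) ↔
          RobinsonTrautman.invI (S.Psi p) * RobinsonTrautman.invJ (S.Psi p) ≠ 0 ∧
          RobinsonTrautman.covariantR (S.Psi p) ≠ 0)) ∧
      -- type II is generic where `K` is not stationary in `x, y`
      (∀ q : ℝ → ℝ, S.IsCharge Ω q →
        (∀ ε : ℝ, (S.withMass (fun u => S.m u + ε * q u ^ 3)).IsSolution Ω) ∧
        (∀ p ∈ Ω, (RobinsonTrautman.pd 2 S.K p ≠ 0 ∨ RobinsonTrautman.pd 3 S.K p ≠ 0) →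
          {ε : ℝ | ¬ RobinsonTrautman.IsTypeII
            ((S.withMass (fun u => S.m u + ε * q u ^ 3)).Psi p)}.encard ≤ 2)) ∧
      -- type D (or conformally flat) if `K` does not depend on `x, y`
      (∀ κ : ℝ → ℝ, (∀ p ∈ Ω, S.K p = κ (p 0)) →
        (∀ p ∈ Ω, S.Psi p 3 = 0 ∧ S.Psi p 4 = 0 ∧
          (S.Psi p 2 ≠ 0 → RobinsonTrautman.IsTypeD (S.Psi p)) ∧
          (S.Psi p 2 = 0 → RobinsonTrautman.IsTypeO (S.Psi p))) ∧
        (∀ q : ℝ → ℝ, S.IsCharge Ω q → ∀ p ∈ Ω,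
          {ε : ℝ | ¬ RobinsonTrautman.IsTypeD
            ((S.withMass (fun u => S.m u + ε * q u ^ 3)).Psi p)}.encard ≤ 1)) ∧
      -- never type N on an open set
      interior {p | p ∈ Ω ∧ RobinsonTrautman.IsTypeN (S.Psi p)} = ∅) ∧
    -- every theory with a static spherically symmetric solution has solutions of type II
    (∀ (Lam : ℝ) (L : ℝ → ℝ) (J : Set ℝ) (m₀ : ℝ) (f E : ℝ → ℝ),
      (RobinsonTrautman.RTData.static Lam L RobinsonTrautman.RTData.sphereP m₀ f E).IsSolution
        {p | p 1 ∈ J} →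
      ∃ (P : ℝ → ℝ → ℝ) (V : Set (ℝ × ℝ)), V.Nonempty ∧
        (∀ m : ℝ, (RobinsonTrautman.RTData.static Lam L P m f E).IsSolution
          {p | p 1 ∈ J ∧ (p 2, p 3) ∈ V}) ∧
        ∀ p : RobinsonTrautman.Coord, p 1 ∈ J → (p 2, p 3) ∈ V →
          {m : ℝ | ¬ RobinsonTrautman.IsTypeII
            ((RobinsonTrautman.RTData.static Lam L P m f E).Psi p)}.encard ≤ 2) ∧
    -- in particular such solutions exist for the Maxwell Lagrangian
    (∀ Lam : ℝ, ∃ (Ω : Set RobinsonTrautman.Coord) (S : RobinsonTrautman.RTData),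
      Ω.Nonempty ∧ S.Lam = Lam ∧ S.L = (fun F => -F) ∧ S.IsSolution Ω ∧
      ∀ p ∈ Ω, RobinsonTrautman.IsTypeII (S.Psi p)) := by
  refine ⟨fun Ω S hS => ?_, fun Lam L J m₀ f E h => ?_, fun Lam => ?_⟩
  · have hR := hS.isRegular
    refine ⟨fun p hp => ?_, fun q hq => ⟨hS.withMass hq, fun p hp hK => ?_⟩,
      fun κ hκ => ⟨fun p hp => ?_, fun q hq p hp => ?_⟩, hR.interior_isTypeN⟩
    · have h0 := hR.Psi_zero hp
      have h1 := hR.Psi_one hp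
      refine ⟨hR.isNullTetrad hp, h0, h1, hR.Psi_two hp, hR.Psi_three hp, hR.Psi_four hp, ?_,
        RobinsonTrautman.covariantR_five h0 h1, RobinsonTrautman.covariantR_six h1,
        RobinsonTrautman.covariantR_low h0 h1, RobinsonTrautman.isTypeII_iff h0 h1⟩
      rw [RobinsonTrautman.invI_eq h0 h1, RobinsonTrautman.invJ_eq h0 h1]
      ring
    · have hR' (ε : ℝ) := (hS.withMass hq ε).isRegular
      -- The slope of `Ψ₂` in `ε`, coming from the term `-m / r³`.
      have hb : -(q (p 0) ^ 3 / p 1 ^ 3) ≠ 0 := neg_ne_zero.2 (div_ne_zero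
        (pow_ne_zero 3 (hq.ne_zero hS hp)) (pow_ne_zero 3 (hR.r_pos p hp).ne'))
      have h3 : S.Psi p 3 ≠ 0 := fun h => by
        have := (hR.Psi_three_eq_zero_iff hp).1 h
        exact hK.elim (fun h => h this.1) (fun h => h this.2)
      refine RobinsonTrautman.encard_not_isTypeII_le (fun ε => (hR' ε).Psi_zero hp)
        (fun ε => (hR' ε).Psi_one hp) hb (fun ε => ((hR' ε).Psi_two hp).trans ?_) h3
        (fun ε => ((hR' ε).Psi_three hp).trans (hR.Psi_three hp).symm)
        (fun ε => ((hR' ε).Psi_four hp).trans (hR.Psi_four hp).symm)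
        (a := (1 / 12) * (RobinsonTrautman.pd 1 (RobinsonTrautman.pd 1 S.Qf) p
          - 2 / p 1 * RobinsonTrautman.pd 1 S.Qf p + 2 / p 1 ^ 2 * S.Qf p) - S.mf p / p 1 ^ 3)
      refine congrArg Complex.ofReal ?_
      change (1 / 12) * (RobinsonTrautman.pd 1 (RobinsonTrautman.pd 1 S.Qf) p
          - 2 / p 1 * RobinsonTrautman.pd 1 S.Qf p + 2 / p 1 ^ 2 * S.Qf p)
          - (S.mf p + ε * q (p 0) ^ 3) / p 1 ^ 3 = _
      ring
    · have hK (z) (hz : z ∈ Ω) := hR.pd_K_eq_zero hκ hz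
      have h0 := hR.Psi_zero hp
      have h1 := hR.Psi_one hp
      have h3 := (hR.Psi_three_eq_zero_iff hp).2 (hK p hp)
      have h4 := hR.Psi_four_eq_zero_of hS.isOpen hK hp hp
      refine ⟨h3, h4, fun h2 => RobinsonTrautman.isTypeD_of h0 h1 h2 h3 h4, fun h2 => ?_⟩
      funext n
      fin_cases n
      exacts [h0, h1, h2, h3, h4]
    · have hR' (ε : ℝ) := (hS.withMass hq ε).isRegular
      have hK (z) (hz : z ∈ Ω) := hR.pd_K_eq_zero hκ hz
      have hb : -(q (p 0) ^ 3 / p 1 ^ 3) ≠ 0 := neg_ne_zero.2 (div_ne_zero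
        (pow_ne_zero 3 (hq.ne_zero hS hp)) (pow_ne_zero 3 (hR.r_pos p hp).ne'))
      refine RobinsonTrautman.encard_not_isTypeD_le (fun ε => (hR' ε).Psi_zero hp)
        (fun ε => (hR' ε).Psi_one hp) hb (fun ε => ((hR' ε).Psi_two hp).trans ?_)
        (fun ε => ((hR' ε).Psi_three_eq_zero_iff hp).2 (hK p hp))
        (fun ε => (hR' ε).Psi_four_eq_zero_of hS.isOpen hK hp hp)
        (a := (1 / 12) * (RobinsonTrautman.pd 1 (RobinsonTrautman.pd 1 S.Qf) p
          - 2 / p 1 * RobinsonTrautman.pd 1 S.Qf p + 2 / p 1 ^ 2 * S.Qf p) - S.mf p / p 1 ^ 3)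
      refine congrArg Complex.ofReal ?_
      change (1 / 12) * (RobinsonTrautman.pd 1 (RobinsonTrautman.pd 1 S.Qf) p
          - 2 / p 1 * RobinsonTrautman.pd 1 S.Qf p + 2 / p 1 ^ 2 * S.Qf p)
          - (S.mf p + ε * q (p 0) ^ 3) / p 1 ^ 3 = _
      ring
  · refine ⟨RobinsonTrautman.RTData.cubicP, {v | 0 < v.1}, ⟨(1, 0), by simp⟩,
      fun m => RobinsonTrautman.RTData.static_isSolution_cubicP h, fun p hpJ hpV => ?_⟩
    have hsol (m : ℝ) := RobinsonTrautman.RTData.static_isSolution_cubicP (m := m) h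
    have hR (m : ℝ) := (hsol m).isRegular
    have hp : p ∈ {p : RobinsonTrautman.Coord |
      p 1 ∈ J ∧ (p 2, p 3) ∈ {v : ℝ × ℝ | 0 < v.1}} := ⟨hpJ, hpV⟩
    have hr := ((hR 0).r_pos p hp).ne'
    -- Now the parameter is `m` itself, so the slope of `Ψ₂` is `-1 / r³`. The scalars `Ψ₃, Ψ₄` do
    -- not involve `m` and are compared with their values at `m = 0`.
    have hb : -(1 / p 1 ^ 3) ≠ 0 := neg_ne_zero.2 (one_div_ne_zero (pow_ne_zero 3 hr))
    have h3 : (RobinsonTrautman.RTData.static Lam L RobinsonTrautman.RTData.cubicP 0 f E).Psi p 3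
        ≠ 0 := fun h => by
      have := ((hR 0).Psi_three_eq_zero_iff hp).1 h
      rw [RobinsonTrautman.RTData.pd_K_cubicP (hR 0).isOpen (fun z hz => hz.2) hp] at this
      norm_num at this
    refine RobinsonTrautman.encard_not_isTypeII_le (fun m => (hR m).Psi_zero hp)
      (fun m => (hR m).Psi_one hp) hb (fun m => ((hR m).Psi_two hp).trans ?_) h3
      (fun m => ((hR m).Psi_three hp).trans ((hR 0).Psi_three hp).symm)
      (fun m => ((hR m).Psi_four hp).trans ((hR 0).Psi_four hp).symm)
      (a := (1 / 12) * (RobinsonTrautman.pd 1 (RobinsonTrautman.pd 1 fun z => f (z 1)) p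
        - 2 / p 1 * RobinsonTrautman.pd 1 (fun z => f (z 1)) p + 2 / p 1 ^ 2 * f (p 1)))
    refine congrArg Complex.ofReal ?_
    change (1 / 12) * (RobinsonTrautman.pd 1 (RobinsonTrautman.pd 1 fun z => f (z 1)) p
        - 2 / p 1 * RobinsonTrautman.pd 1 (fun z => f (z 1)) p + 2 / p 1 ^ 2 * f (p 1))
        - m / p 1 ^ 3 = _
    ring
  · obtain ⟨h, h'⟩ := RobinsonTrautman.RTData.maxwell_isSolution_cubicP Lam
    exact ⟨{p | 0 < p 1 ∧ 0 < p 2}, RobinsonTrautman.RTData.static Lam (fun F => -F)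
      RobinsonTrautman.RTData.cubicP 0 (fun r => (r ^ 2)⁻¹) (fun r => (r ^ 2)⁻¹),
      ⟨fun _ => 1, by simp⟩, rfl, rfl, h, fun p hp => h' p hp.1 hp.2⟩
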